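/- Let $G$ be a finite simple graph with maximum degree $\Delta\ge 1$. A coloring of $G$ is a function $f:V(G)\to\mathbb N$. A graph is $k$-degenerate if each of its nonempty subgraphs has a vertex of degree less than $k$. The coloring $f$ is degenerate if, for every $k\ge 1$, the union of any $k$ color classes $f^{-1}(i)$, $i\in f(V(G))$, induces a $k$-degenerate subgraph of $G$. It is a star coloring if adjacent vertices always receive different colors and no (not necessarily induced) path on four vertices of $G$ is colored with exactly two colors. A degenerate star coloring is a coloring that is both degenerate and star, and $\chi_{sd}(G)$ denotes the least $n$ such that $G$ has a degenerate star coloring $f$ with $|f(V(G))|\le n$. Suppose that every vertex $v$ is given a list $L(v)\subseteq\mathbb N$ with $|L(v)|\ge\lceil 1000\,\Delta^{3/2}\rceil$. Then there is a degenerate star coloring $f$ of $G$ with $f(v)\in L(v)$ for every vertex $v$ such that, moreover, for every vertex $v$ of degree at most $\Delta^{1/2}$, the neighbors of $v$ receive pairwise different colors. In particular, $\chi_{sd}(G)\le\lceil 1000\,\Delta^{3/2}\rceil$. -/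

import Mathlib

namespace DegStar

/-- Every (nonempty) subgraph of `G` has a vertex of degree less than `k`. -/
def IsDegenerate {V : Type*} (G : SimpleGraph V) (k : ℕ) : Prop :=
  ∀ H : G.Subgraph, H.verts.Nonempty → ∃ v ∈ H.verts, (H.neighborSet v).encard < k

/-- Proper coloring: adjacent vertices receive different colors. -/
def IsProperColoring {V : Type*} (G : SimpleGraph V) (f : V → ℕ) : Prop :=
  ∀ x y, G.Adj x y → f x ≠ f y

/-- For every `k ≥ 1`, the union of any `k` color classes `f ⁻¹' {i}`, `i ∈ f(V)`, induces
a `k`-degenerate subgraph. -/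
def IsDegenerateColoring {V : Type*} (G : SimpleGraph V) (f : V → ℕ) : Prop :=
  ∀ k : ℕ, 1 ≤ k → ∀ S : Finset ℕ, (S : Set ℕ) ⊆ Set.range f → S.card = k →
    IsDegenerate (G.induce {v | f v ∈ S}) k

/-- Proper coloring in which no path `a b c d` on four distinct vertices (not necessarily
induced) is colored with exactly two colors. -/
def IsStarColoring {V : Type*} (G : SimpleGraph V) (f : V → ℕ) : Prop :=
  IsProperColoring G f ∧
    ∀ a b c d, [a, b, c, d].Nodup → G.Adj a b → G.Adj b c → G.Adj c d →
      ({f a, f b, f c, f d} : Finset ℕ).card ≠ 2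

/-- Both degenerate and star. -/
def IsDegenerateStarColoring {V : Type*} (G : SimpleGraph V) (f : V → ℕ) : Prop :=
  IsDegenerateColoring G f ∧ IsStarColoring G f

/-- The degenerate star chromatic number: the least `n` for which there is a degenerate star
coloring `f` with `|f(V)| ≤ n` (and `⊤` if there is no such `n`). -/
noncomputable def degenerateStarChromaticNumber {V : Type*} (G : SimpleGraph V) : ℕ∞ :=
  ⨅ n ∈ {n : ℕ | ∃ f : V → ℕ, (Set.range f).encard ≤ n ∧ IsDegenerateStarColoring G f}, (n : ℕ∞)

end DegStar

/-! The proof counts partial colorings. Put `s = Δ ^ (1/2)` and `β = 900 s³`. By induction on `S`,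
adding a vertex `v` multiplies the number of good list colorings of `S` by at least `β`
(`mul_card_goodColorings_le`), so a good coloring of the whole graph exists. Each bad extension
matches a pattern `(U, φ)` with `v ∈ U`: the color of every `u ∈ U` is copied from `φ u ∉ U`. The
extensions matching one pattern are determined by their restriction to `S \ U`, and by induction
there are at most `β ^ (-(|U| - 1))` times as many of those restrictions as good colorings of `S`.
It remains to bound the total weight of the patterns at `v` by `100 s³` (`sum_badPatterns_le`).

Edges, small vertices and bicolored paths are local and contribute `O(Δ ^ (3/2))`. Degeneracy is not
local and is replaced by the absence of dense cores: connected sets with `c` colors, every color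
used at least three times, and at most `c` vertices of degree below `c`. A set violating degeneracy
has minimum degree at least its number of colors. Deleting classes of size at most two and passing
to unions of components preserves an averaged form of this condition, and ends in a dense core
(`HasLargeMonoDegrees.exists_isDenseCore`). Excluding bicolored paths is what makes the deletion
affordable.

A core on `J ≥ 3c` vertices forces `J - c ≥ 2J/3` color coincidences. The candidate cores at `v` are
summed by a weighted exploration (`sum_exploreWeight_le`) in which each vertex costs of order `Δ /
c`, apart from `c` extra factors `c` for the low-degree vertices. The `c ^ (J - c)` color
assignments cancel these powers of `c`, leaving about `(CΔ) ^ J / β ^ (J - c)`, which is small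
exactly because `β` is a large multiple of `Δ ^ (3/2)`. -/

namespace DegStar

/-! ### Counting good list colorings by weighted patterns. -/

open Classical in
/-- The list colorings of `S`, extended by `0`, that satisfy `good S`. -/
noncomputable def goodColorings {V : Type*} [Fintype V] (L : V → Finset ℕ)
    (good : Finset V → (V → ℕ) → Prop) (S : Finset V) : Finset (V → ℕ) :=
  (Fintype.piFinset fun u => if u ∈ S then L u else {0}).filter (good S)

section Counting

variable {V : Type*} [Fintype V] {L : V → Finset ℕ} {good : Finset V → (V → ℕ) → Prop}

lemma mem_goodColorings {S : Finset V} {f : V → ℕ} :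
    f ∈ goodColorings L good S ↔
      (∀ u ∈ S, f u ∈ L u) ∧ (∀ u ∉ S, f u = 0) ∧ good S f := by
  classical
  simp only [goodColorings, Finset.mem_filter, Fintype.mem_piFinset]
  constructor
  · rintro ⟨h, hg⟩
    refine ⟨fun u hu => by simpa [hu] using h u, fun u hu => by simpa [hu] using h u, hg⟩
  · rintro ⟨h1, h2, hg⟩
    refine ⟨fun u => ?_, hg⟩
    by_cases hu : u ∈ S
    · simpa [hu] using h1 u hu
    · simpa [hu] using h2 u hu

open Classical in
/-- Few colorings of `insert v S` agree along a given pattern `(U, φ)`. -/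
lemma card_pattern_le
    (mono : ∀ S T f, S ⊆ T → good T f → good S f)
    (congr : ∀ S f g, (∀ u ∈ S, f u = g u) → good S f → good S g)
    {S U : Finset V} {v : V} {φ : V → V} {B : Finset (V → ℕ)}
    (hvU : v ∈ U)
    (hB : ∀ f ∈ B, (∀ u ∈ insert v S, f u ∈ L u) ∧ (∀ u ∉ insert v S, f u = 0) ∧ good S f ∧
      U ⊆ insert v S ∧ ∀ u ∈ U, φ u ∈ insert v S ∧ φ u ∉ U ∧ f u = f (φ u)) :
    B.card ≤ (goodColorings L good (S \ U)).card := by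
  -- Restriction to `S \ U` loses nothing: the colors on `U` are read off through `φ`, whose values
  -- lie outside `U`.
  refine Finset.card_le_card_of_injOn (fun f u => if u ∈ S \ U then f u else 0) ?_ ?_
  · intro f hf
    obtain ⟨h1, h2, h3, h4, h5⟩ := hB f hf
    refine mem_goodColorings.2 ⟨fun u hu => ?_, fun u hu => ?_, ?_⟩
    · simp only [hu, if_true]
      exact h1 u (Finset.mem_insert_of_mem (Finset.mem_sdiff.1 hu).1)
    · simp only [hu, if_false]
    · exact congr _ f _ (fun u hu => by simp only [hu, if_true])
        (mono _ S f Finset.sdiff_subset h3)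
  · intro f hf g hg hfg
    obtain ⟨-, f2, -, f4, f5⟩ := hB f hf
    obtain ⟨-, g2, -, g4, g5⟩ := hB g hg
    have key : ∀ u ∈ insert v S, u ∉ U → f u = g u := by
      intro u hu huU
      have huS : u ∈ S \ U := by
        refine Finset.mem_sdiff.2 ⟨?_, huU⟩
        rcases Finset.mem_insert.1 hu with rfl | h
        · exact absurd hvU huU
        · exact h
      have := congrFun hfg u
      simpa [Finset.mem_sdiff.1 huS] using this
    funext u
    by_cases hu : u ∈ insert v S
    · by_cases huU : u ∈ U
      · rw [(f5 u huU).2.2, (g5 u huU).2.2]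
        exact key _ (f5 u huU).1 (f5 u huU).2.1
      · exact key u hu huU
    · rw [f2 u hu, g2 u hu]

open Classical in
-- The one-vertex growth bound telescopes when the vertices of `D` are put back one at a time; each
-- intermediate set is a proper subset of `S`, which is all that strong induction supplies.
lemma pow_mul_card_goodColorings_sdiff_le {β : ℝ} (hβ : 0 < β) {S : Finset V}
    (hstep : ∀ T : Finset V, T ⊂ S → ∀ w, w ∉ T →
      β * (goodColorings L good T).card ≤ (goodColorings L good (insert w T)).card)
    (D : Finset V) (hD : D ⊆ S) :
    β ^ D.card * (goodColorings L good (S \ D)).card ≤ (goodColorings L good S).card := by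
  induction D using Finset.induction_on with
  | empty => simp
  | insert w D hw ih =>
    have hwS : w ∈ S := hD (Finset.mem_insert_self _ _)
    have hDS : D ⊆ S := fun x hx => hD (Finset.mem_insert_of_mem hx)
    have hins : insert w (S \ insert w D) = S \ D := by
      ext x
      by_cases hx : x = w
      · subst hx; simp [hwS, hw]
      · simp [hx]
    have hss : S \ insert w D ⊂ S := by
      refine (Finset.ssubset_iff_of_subset Finset.sdiff_subset).2 ⟨w, hwS, by simp⟩
    have h := hstep _ hss w (by simp)
    rw [hins] at h
    rw [Finset.card_insert_of_notMem hw, pow_succ, mul_assoc]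
    exact (mul_le_mul_of_nonneg_left h (by positivity)).trans (ih hDS)

open Classical in
/-- Every good list coloring of `S` has at least `β` good extensions on average, provided that
the patterns responsible for the bad extensions have small total weight. -/
theorem mul_card_goodColorings_le {β N : ℝ} (hβ : 0 < β)
    (hL : ∀ v, N ≤ (L v).card)
    (mono : ∀ S T f, S ⊆ T → good T f → good S f)
    (congr : ∀ S f g, (∀ u ∈ S, f u = g u) → good S f → good S g)
    (P : V → Finset (Finset V × (V → V)))
    (hP : ∀ S v f, v ∉ S → good S f → ¬ good (insert v S) f →
      ∃ p ∈ P v, v ∈ p.1 ∧ p.1 ⊆ insert v S ∧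
        ∀ u ∈ p.1, p.2 u ∈ insert v S ∧ p.2 u ∉ p.1 ∧ f u = f (p.2 u))
    (hsum : ∀ v, ∑ p ∈ P v, (β ^ (p.1.card - 1))⁻¹ ≤ N - β)
    (S : Finset V) (v : V) (hv : v ∉ S) :
    β * (goodColorings L good S).card ≤ (goodColorings L good (insert v S)).card := by
  induction S using Finset.strongInduction generalizing v with
  | H S ih =>
    set C := goodColorings L good S with hC
    let E : Finset (V → ℕ) := (C ×ˢ L v).image fun q => Function.update q.1 v q.2
    have hEcard : E.card = C.card * (L v).card := by
      rw [← Finset.card_product]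
      refine Finset.card_image_of_injOn ?_
      rintro ⟨g, a⟩ hg ⟨g', a'⟩ hg' h
      simp only [Finset.coe_product, Set.mem_prod, Finset.mem_coe] at hg hg'
      have hg1 := (mem_goodColorings.1 hg.1).2.1 v hv
      have hg2 := (mem_goodColorings.1 hg'.1).2.1 v hv
      have ha : a = a' := by simpa using congrFun h v
      refine Prod.ext ?_ ha
      funext u
      by_cases hu : u = v
      · subst hu; simp only [hg1, hg2]
      · simpa [hu] using congrFun h u
    have hE : ∀ f ∈ E, (∀ u ∈ insert v S, f u ∈ L u) ∧ (∀ u ∉ insert v S, f u = 0) ∧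
        good S f := by
      intro f hf
      obtain ⟨⟨g, a⟩, hga, rfl⟩ := Finset.mem_image.1 hf
      obtain ⟨hg, ha⟩ := Finset.mem_product.1 hga
      obtain ⟨g1, g2, g3⟩ := mem_goodColorings.1 hg
      refine ⟨fun u hu => ?_, fun u hu => ?_, ?_⟩
      · by_cases huv : u = v
        · subst huv; simpa using ha
        · simpa [huv] using g1 u ((Finset.mem_insert.1 hu).resolve_left huv)
      · have huv : u ≠ v := fun h => hu (h ▸ Finset.mem_insert_self _ _)
        simpa [huv] using g2 u fun h => hu (Finset.mem_insert_of_mem h)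
      · refine congr S g _ (fun u hu => ?_) g3
        have huv : u ≠ v := fun h => hv (h ▸ hu)
        simp [huv]
    let B : Finset V × (V → V) → Finset (V → ℕ) := fun p => E.filter fun f =>
      v ∈ p.1 ∧ p.1 ⊆ insert v S ∧
        ∀ u ∈ p.1, p.2 u ∈ insert v S ∧ p.2 u ∉ p.1 ∧ f u = f (p.2 u)
    have hcover : E ⊆ goodColorings L good (insert v S) ∪ (P v).biUnion B := by
      intro f hf
      obtain ⟨h1, h2, h3⟩ := hE f hf
      by_cases hg : good (insert v S) f
      · exact Finset.mem_union_left _ (mem_goodColorings.2 ⟨h1, h2, hg⟩)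
      · obtain ⟨p, hp, hpat⟩ := hP S v f hv h3 hg
        exact Finset.mem_union_right _
          (Finset.mem_biUnion.2 ⟨p, hp, Finset.mem_filter.2 ⟨hf, hpat⟩⟩)
    have hBcard : ∀ p ∈ P v, ((B p).card : ℝ) ≤ (β ^ (p.1.card - 1))⁻¹ * C.card := by
      intro p _
      rcases (B p).eq_empty_or_nonempty with h0 | ⟨f, hf⟩
      · rw [h0]; simp; positivity
      obtain ⟨hvp, hpS, -⟩ := (Finset.mem_filter.1 hf).2
      have h1 : (B p).card ≤ (goodColorings L good (S \ p.1)).card := by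
        refine card_pattern_le (φ := p.2) mono congr hvp fun g hg => ?_
        obtain ⟨hgE, hgp⟩ := Finset.mem_filter.1 hg
        obtain ⟨a, b, c⟩ := hE g hgE
        exact ⟨a, b, c, hgp.2⟩
      -- As `v ∉ S`, only `|U| - 1` vertices of `U` lie in `S`; hence the exponent in the weight of
      -- a pattern.
      have h2 := pow_mul_card_goodColorings_sdiff_le (good := good) (L := L) hβ
        (S := S) (fun T hT w hw => ih T hT w hw) (p.1.erase v) (by
          intro x hx
          obtain ⟨hxv, hx⟩ := Finset.mem_erase.1 hx
          exact (Finset.mem_insert.1 (hpS hx)).resolve_left hxv)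
      have h3 : S \ p.1.erase v = S \ p.1 := by
        ext x
        by_cases hx : x = v
        · subst hx; simp [hv]
        · simp [hx]
      rw [h3, Finset.card_erase_of_mem hvp] at h2
      rw [inv_mul_eq_div, le_div_iff₀ (by positivity), mul_comm]
      exact (mul_le_mul_of_nonneg_left (by exact_mod_cast h1) (by positivity)).trans h2
    have htot : (E.card : ℝ) ≤ (goodColorings L good (insert v S)).card +
        ∑ p ∈ P v, ((B p).card : ℝ) := by
      have := (Finset.card_le_card hcover).trans (Finset.card_union_le _ _)
      have h' := this.trans (Nat.add_le_add_left Finset.card_biUnion_le _)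
      exact_mod_cast h'
    have hsum' : ∑ p ∈ P v, ((B p).card : ℝ) ≤ (N - β) * C.card :=
      calc ∑ p ∈ P v, ((B p).card : ℝ)
          ≤ ∑ p ∈ P v, (β ^ (p.1.card - 1))⁻¹ * C.card := Finset.sum_le_sum hBcard
        _ = (∑ p ∈ P v, (β ^ (p.1.card - 1))⁻¹) * C.card := by rw [Finset.sum_mul]
        _ ≤ _ := mul_le_mul_of_nonneg_right (hsum v) (by positivity)
    have hEN : N * C.card ≤ (E.card : ℝ) := by
      rw [hEcard]; push_cast
      rw [mul_comm (C.card : ℝ)]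
      exact mul_le_mul_of_nonneg_right (hL v) (by positivity)
    linarith

open Classical in
theorem exists_good_list_coloring {β N : ℝ} (hβ : 0 < β)
    (hL : ∀ v, N ≤ (L v).card)
    (hempty : ∀ f, good ∅ f)
    (mono : ∀ S T f, S ⊆ T → good T f → good S f)
    (congr : ∀ S f g, (∀ u ∈ S, f u = g u) → good S f → good S g)
    (P : V → Finset (Finset V × (V → V)))
    (hP : ∀ S v f, v ∉ S → good S f → ¬ good (insert v S) f →
      ∃ p ∈ P v, v ∈ p.1 ∧ p.1 ⊆ insert v S ∧
        ∀ u ∈ p.1, p.2 u ∈ insert v S ∧ p.2 u ∉ p.1 ∧ f u = f (p.2 u))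
    (hsum : ∀ v, ∑ p ∈ P v, (β ^ (p.1.card - 1))⁻¹ ≤ N - β) :
    ∃ f : V → ℕ, (∀ v, f v ∈ L v) ∧ good Finset.univ f := by
  have hpos : ∀ S : Finset V, 0 < (goodColorings L good S).card := by
    intro S
    induction S using Finset.induction_on with
    | empty =>
      exact Finset.card_pos.2 ⟨fun _ => 0, mem_goodColorings.2 ⟨by simp, by simp, hempty _⟩⟩
    | insert v S hv ih =>
      have h := mul_card_goodColorings_le hβ hL mono congr P hP hsum S v hv
      have : (0 : ℝ) < (goodColorings L good (insert v S)).card :=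
        lt_of_lt_of_le (mul_pos hβ (by exact_mod_cast ih)) h
      exact_mod_cast this
  obtain ⟨f, hf⟩ := Finset.card_pos.1 (hpos Finset.univ)
  obtain ⟨h1, -, h3⟩ := mem_goodColorings.1 hf
  exact ⟨f, fun v => h1 v (Finset.mem_univ _), h3⟩

end Counting

/-! ### Weighted enumeration of connected sets by exploration. -/

section Exploration

variable {V : Type*} (G : SimpleGraph V)

open Classical in
/-- The number of neighbors of `u` in the finite set `Y`. -/
noncomputable def degreeIn (Y : Finset V) (u : V) : ℕ := (Y.filter fun w => G.Adj u w).card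

/-- Every set between `A` and `Y`, other than `Y`, has an edge to the rest of `Y`. -/
def ReachableFrom (A Y : Finset V) : Prop :=
  ∀ P, A ⊆ P → P ⊆ Y → P ≠ Y → ∃ p ∈ P, ∃ y ∈ Y, y ∉ P ∧ G.Adj p y

variable {G}

lemma ReachableFrom.mono {A B Y : Finset V} (h : ReachableFrom G A Y) (hAB : A ⊆ B) :
    ReachableFrom G B Y := fun P hP => h P (hAB.trans hP)

open Classical in
lemma degreeIn_pos_of_adj {Y : Finset V} {u w : V} (hw : w ∈ Y) (h : G.Adj u w) :
    0 < degreeIn G Y u :=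
  Finset.card_pos.2 ⟨w, by simp [hw, h]⟩

open Classical in
lemma degreeIn_insert (Y : Finset V) {u w : V} (hu : u ∉ Y) :
    degreeIn G (insert u Y) w = degreeIn G Y w + if G.Adj w u then 1 else 0 := by
  unfold degreeIn
  rw [Finset.filter_insert]
  split_ifs with h
  · rw [Finset.card_insert_of_notMem (by simp [hu])]
  · rfl

open Classical in
lemma degreeIn_insert_le (Y : Finset V) (u w : V) :
    degreeIn G (insert u Y) w ≤ degreeIn G Y w + if G.Adj w u then 1 else 0 := by
  by_cases hu : u ∈ Y
  · rw [Finset.insert_eq_of_mem hu]; exact Nat.le_add_right _ _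
  · exact (degreeIn_insert Y hu).le

variable (G) in
/-- The exponent governing the number of ways to extend the explored set `A` with hubs `H`
inside the undecided set `D`. -/
noncomputable def energy (c : ℕ) (A H D : Finset V) : ℝ :=
  ∑ u ∈ D, ((degreeIn G A u : ℝ) + c / 2 * degreeIn G H u)

open Classical in
variable (G) in
/-- The weight of completing the explored set `A` with hubs `H` to `Y`. -/
noncomputable def exploreWeight (c : ℕ) (z κ : ℝ) (A H Y : Finset V) : ℝ :=
  z ^ (Y \ A).card * ((c : ℝ)⁻¹) ^ ((Y \ A).filter fun y => degreeIn G Y y < c).card *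
    κ ^ ((Y \ A).filter fun y => degreeIn G H y = 0).card

open Classical in
variable (G) in
/-- The sets reachable from `A` using vertices in `D`. -/
noncomputable def reachableSets [Fintype V] (A D : Finset V) : Finset (Finset V) :=
  Finset.univ.filter fun Y => A ⊆ Y ∧ Y ⊆ A ∪ D ∧ ReachableFrom G A Y

open Classical in
lemma energy_erase (c : ℕ) (A H : Finset V) {D : Finset V} {u : V} (hu : u ∈ D) :
    energy G c A H (D.erase u) =
      energy G c A H D - ((degreeIn G A u : ℝ) + c / 2 * degreeIn G H u) := by
  unfold energy
  rw [← Finset.add_sum_erase _ _ hu]; ring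

lemma energy_nonneg (c : ℕ) (A H D : Finset V) : 0 ≤ energy G c A H D :=
  Finset.sum_nonneg fun _ _ => by positivity

open Classical in
lemma sum_adj_le [Fintype V] {Δ : ℕ} (hΔ : ∀ u, degreeIn G Finset.univ u ≤ Δ)
    (D : Finset V) (u : V) : ∑ w ∈ D, ((if G.Adj w u then 1 else 0 : ℕ) : ℝ) ≤ Δ := by
  rw [← Nat.cast_sum, Finset.sum_boole]
  have : (D.filter fun w => G.Adj w u).card ≤ degreeIn G Finset.univ u :=
    Finset.card_le_card fun w hw => by
      simp only [Finset.mem_filter, Finset.mem_univ, true_and] at hw ⊢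
      exact hw.2.symm
  exact_mod_cast this.trans (hΔ u)

open Classical in
lemma energy_insert_le [Fintype V] {Δ : ℕ} (hΔ : ∀ u, degreeIn G Finset.univ u ≤ Δ)
    (c : ℕ) (A H D : Finset V) (u : V) :
    energy G c (insert u A) H D ≤ energy G c A H D + Δ := by
  calc energy G c (insert u A) H D
      ≤ ∑ w ∈ D, (((degreeIn G A w : ℝ) + c / 2 * degreeIn G H w) +
          ((if G.Adj w u then 1 else 0 : ℕ) : ℝ)) := by
        refine Finset.sum_le_sum fun w _ => ?_
        have : (degreeIn G (insert u A) w : ℝ) ≤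
            degreeIn G A w + ((if G.Adj w u then 1 else 0 : ℕ) : ℝ) := by
          exact_mod_cast degreeIn_insert_le A u w
        linarith
    _ ≤ _ := by
        rw [Finset.sum_add_distrib]
        exact add_le_add le_rfl (sum_adj_le hΔ D u)

open Classical in
lemma energy_insert_hub_le [Fintype V] {Δ : ℕ} (hΔ : ∀ u, degreeIn G Finset.univ u ≤ Δ)
    (c : ℕ) (A H D : Finset V) (u : V) :
    energy G c A (insert u H) D ≤ energy G c A H D + c / 2 * Δ := by
  calc energy G c A (insert u H) D
      ≤ ∑ w ∈ D, (((degreeIn G A w : ℝ) + c / 2 * degreeIn G H w) +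
          c / 2 * ((if G.Adj w u then 1 else 0 : ℕ) : ℝ)) := by
        refine Finset.sum_le_sum fun w _ => ?_
        have : (degreeIn G (insert u H) w : ℝ) ≤
            degreeIn G H w + ((if G.Adj w u then 1 else 0 : ℕ) : ℝ) := by
          exact_mod_cast degreeIn_insert_le H u w
        have h2 := mul_le_mul_of_nonneg_left this (by positivity : (0 : ℝ) ≤ (c : ℝ) / 2)
        linarith
    _ ≤ _ := by
        rw [Finset.sum_add_distrib, ← Finset.mul_sum]
        exact add_le_add le_rfl (mul_le_mul_of_nonneg_left (sum_adj_le hΔ D u) (by positivity))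

lemma exploreWeight_nonneg {c : ℕ} {z κ : ℝ} (hz : 0 ≤ z) (hκ : 0 ≤ κ) (A H Y : Finset V) :
    0 ≤ exploreWeight G c z κ A H Y := by
  unfold exploreWeight; positivity

open Classical in
lemma sdiff_eq_insert_of_mem {A Y : Finset V} {u : V} (hA : u ∉ A) (hY : u ∈ Y) :
    Y \ A = insert u (Y \ insert u A) := by
  ext w
  by_cases hw : w = u
  · subst hw; simp [hA, hY]
  · simp [hw]

open Classical in
lemma exploreWeight_le_of_mem {c : ℕ} {z κ : ℝ} (hc : 1 ≤ c) (hz : 0 ≤ z) (hκ : 0 ≤ κ)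
    (hκ1 : κ ≤ 1) {A H Y : Finset V} {u : V} (hA : u ∉ A) (hY : u ∈ Y) :
    exploreWeight G c z κ A H Y ≤ z * exploreWeight G c z κ (insert u A) H Y := by
  have hc' : (c : ℝ)⁻¹ ≤ 1 := inv_le_one_of_one_le₀ (by exact_mod_cast hc)
  have hsub : Y \ insert u A ⊆ Y \ A :=
    Finset.sdiff_subset_sdiff subset_rfl (Finset.subset_insert _ _)
  unfold exploreWeight
  have h0 : (Y \ A).card = (Y \ insert u A).card + 1 := by
    rw [sdiff_eq_insert_of_mem hA hY, Finset.card_insert_of_notMem (by simp)]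
  rw [h0, pow_succ', mul_assoc, mul_assoc, mul_assoc]
  refine mul_le_mul_of_nonneg_left (mul_le_mul_of_nonneg_left ?_ (by positivity)) hz
  refine mul_le_mul ?_ ?_ (by positivity) (by positivity)
  · exact pow_le_pow_of_le_one (by positivity) hc'
      (Finset.card_le_card (Finset.filter_subset_filter _ hsub))
  · exact pow_le_pow_of_le_one hκ hκ1
      (Finset.card_le_card (Finset.filter_subset_filter _ hsub))

open Classical in
lemma exploreWeight_le_of_low {c : ℕ} {z κ : ℝ} (hz : 0 ≤ z) (hκ : 0 ≤ κ)
    (hκ1 : κ ≤ 1) {A H Y : Finset V} {u : V} (hA : u ∉ A) (hY : u ∈ Y)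
    (hlow : degreeIn G Y u < c) :
    exploreWeight G c z κ A H Y ≤ z * (c : ℝ)⁻¹ * exploreWeight G c z κ (insert u A) H Y := by
  have hsub : Y \ insert u A ⊆ Y \ A :=
    Finset.sdiff_subset_sdiff subset_rfl (Finset.subset_insert _ _)
  unfold exploreWeight
  have h0 : (Y \ A).card = (Y \ insert u A).card + 1 := by
    rw [sdiff_eq_insert_of_mem hA hY, Finset.card_insert_of_notMem (by simp)]
  have h1 : ((Y \ A).filter fun y => degreeIn G Y y < c).card =
      ((Y \ insert u A).filter fun y => degreeIn G Y y < c).card + 1 := by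
    rw [sdiff_eq_insert_of_mem hA hY, Finset.filter_insert, if_pos hlow,
      Finset.card_insert_of_notMem (by simp)]
  have h2 : κ ^ ((Y \ A).filter fun y => degreeIn G H y = 0).card ≤
      κ ^ ((Y \ insert u A).filter fun y => degreeIn G H y = 0).card :=
    pow_le_pow_of_le_one hκ hκ1 (Finset.card_le_card (Finset.filter_subset_filter _ hsub))
  rw [h0, h1, pow_succ', pow_succ']
  calc _ = z * (c : ℝ)⁻¹ * (z ^ (Y \ insert u A).card *
        (c : ℝ)⁻¹ ^ ((Y \ insert u A).filter fun y => degreeIn G Y y < c).card) *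
        κ ^ ((Y \ A).filter fun y => degreeIn G H y = 0).card := by ring
    _ ≤ z * (c : ℝ)⁻¹ * (z ^ (Y \ insert u A).card *
        (c : ℝ)⁻¹ ^ ((Y \ insert u A).filter fun y => degreeIn G Y y < c).card) *
        κ ^ ((Y \ insert u A).filter fun y => degreeIn G H y = 0).card :=
        mul_le_mul_of_nonneg_left h2 (by positivity)
    _ = _ := by ring

open Classical in
lemma degreeIn_eq_add_sdiff {A Y : Finset V} (h : A ⊆ Y) (u : V) :
    degreeIn G Y u = degreeIn G A u + degreeIn G (Y \ A) u := by
  unfold degreeIn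
  rw [← Finset.card_union_of_disjoint]
  · rw [← Finset.filter_union, Finset.union_sdiff_of_subset h]
  · exact Finset.disjoint_filter_filter Finset.disjoint_sdiff

open Classical in
-- A vertex `u` of high degree in `Y` with few neighbors in `A` has at least `c / 2` neighbors in `Y
-- \ A`. None of these was adjacent to a hub, so making `u` a hub releases one factor `κ` for each,
-- and together these are at most `b`.
lemma exploreWeight_le_of_hub {c : ℕ} {z κ b : ℝ} (hc : 1 ≤ c) (hz : 0 ≤ z) (hκ : 0 ≤ κ)
    (hκ1 : κ ≤ 1) (hb : ∀ m : ℕ, c ≤ 2 * m → κ ^ m ≤ b)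
    {A H Y : Finset V} {u : V} (hA : u ∉ A) (hAY : A ⊆ Y) (hY : u ∈ Y)
    (hhigh : c ≤ degreeIn G Y u) (hpoor : 2 * degreeIn G A u < c)
    (hH : ∀ w ∈ Y \ A, degreeIn G H w = 0) :
    exploreWeight G c z κ A H Y ≤
      z * b * exploreWeight G c z κ (insert u A) (insert u H) Y := by
  have hc' : (c : ℝ)⁻¹ ≤ 1 := inv_le_one_of_one_le₀ (by exact_mod_cast hc)
  have hsub : Y \ insert u A ⊆ Y \ A :=
    Finset.sdiff_subset_sdiff subset_rfl (Finset.subset_insert _ _)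
  set m := degreeIn G (Y \ A) u with hm
  have hm2 : c ≤ 2 * m := by
    have := degreeIn_eq_add_sdiff (G := G) hAY u
    omega
  set r' := ((Y \ insert u A).filter fun y => degreeIn G (insert u H) y = 0).card with hr'
  have hr : r' + m ≤ ((Y \ A).filter fun y => degreeIn G H y = 0).card := by
    rw [hr', hm, degreeIn, ← Finset.card_union_of_disjoint]
    · refine Finset.card_le_card fun y hy => ?_
      rcases Finset.mem_union.1 hy with hy | hy
      · have hy1 := hsub (Finset.mem_filter.1 hy).1
        exact Finset.mem_filter.2 ⟨hy1, hH y hy1⟩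
      · have hy1 := (Finset.mem_filter.1 hy).1
        exact Finset.mem_filter.2 ⟨hy1, hH y hy1⟩
    · rw [Finset.disjoint_left]
      intro y hy hy'
      have h1 := (Finset.mem_filter.1 hy).2
      have h2 := (Finset.mem_filter.1 hy').2
      have := degreeIn_pos_of_adj (G := G) (Finset.mem_insert_self u H) h2.symm
      omega
  have hκr : κ ^ ((Y \ A).filter fun y => degreeIn G H y = 0).card ≤ b * κ ^ r' :=
    calc _ ≤ κ ^ (r' + m) := pow_le_pow_of_le_one hκ hκ1 hr
      _ = κ ^ m * κ ^ r' := by rw [pow_add, mul_comm]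
      _ ≤ _ := mul_le_mul_of_nonneg_right (hb m hm2) (by positivity)
  have hb0 : 0 ≤ b := le_trans (by positivity) (hb m hm2)
  have h0 : (Y \ A).card = (Y \ insert u A).card + 1 := by
    rw [sdiff_eq_insert_of_mem hA hY, Finset.card_insert_of_notMem (by simp)]
  unfold exploreWeight
  rw [h0, pow_succ']
  calc _ ≤ z * z ^ (Y \ insert u A).card *
        (c : ℝ)⁻¹ ^ ((Y \ insert u A).filter fun y => degreeIn G Y y < c).card *
        (b * κ ^ r') := by
        refine mul_le_mul (mul_le_mul_of_nonneg_left ?_ (by positivity)) hκr (by positivity)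
          (by positivity)
        exact pow_le_pow_of_le_one (by positivity) hc'
          (Finset.card_le_card (Finset.filter_subset_filter _ hsub))
    _ = _ := by ring

open Classical in
-- Branch on whether `u` belongs to `Y`. Reachability survives enlarging the starting set, so the
-- sets containing `u` are reachable from `insert u A`.
lemma sum_reachableSets_le [Fintype V] {A D : Finset V} {u : V} (hu : u ∈ D)
    {w R : Finset V → ℝ} (hR : ∀ Y, 0 ≤ R Y)
    (hw : ∀ Y ∈ reachableSets G A D, u ∈ Y → w Y ≤ R Y) :
    ∑ Y ∈ reachableSets G A D, w Y ≤ ∑ Y ∈ reachableSets G A (D.erase u), w Y +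
      ∑ Y ∈ reachableSets G (insert u A) (D.erase u), R Y := by
  rw [← Finset.sum_filter_add_sum_filter_not (reachableSets G A D) (fun Y => u ∈ Y) w, add_comm]
  have hmem : ∀ {A D Y}, Y ∈ reachableSets G A D ↔
      A ⊆ Y ∧ Y ⊆ A ∪ D ∧ ReachableFrom G A Y := by
    intro A D Y; simp [reachableSets]
  by_cases huA : u ∈ A
  · have h1 : (reachableSets G A D).filter (fun Y => ¬ u ∈ Y) = ∅ := by
      refine Finset.filter_eq_empty_iff.2 fun Y hY hn => hn ((hmem.1 hY).1 huA)
    have h2 : reachableSets G A D = reachableSets G A (D.erase u) := by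
      have : A ∪ D.erase u = A ∪ D := by
        ext x
        by_cases hx : x = u
        · subst hx; simp [huA]
        · simp [hx]
      ext Y
      rw [hmem, hmem, this]
    rw [h1, Finset.sum_empty, zero_add]
    refine le_add_of_le_of_nonneg ?_ (Finset.sum_nonneg fun Y _ => hR Y)
    rw [← h2]
    have : (reachableSets G A D).filter (fun Y => u ∈ Y) = reachableSets G A D :=
      Finset.filter_true_of_mem fun Y hY => (hmem.1 hY).1 huA
    rw [this]
  refine add_le_add (le_of_eq ?_) ?_
  · refine Finset.sum_congr ?_ fun _ _ => rfl
    ext Y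
    rw [Finset.mem_filter, hmem, hmem]
    constructor
    · rintro ⟨⟨h1, h2, h3⟩, h4⟩
      refine ⟨h1, fun x hx => ?_, h3⟩
      rcases Finset.mem_union.1 (h2 hx) with h | h
      · exact Finset.mem_union_left _ h
      · exact Finset.mem_union_right _ (Finset.mem_erase.2 ⟨fun e => h4 (e ▸ hx), h⟩)
    · rintro ⟨h1, h2, h3⟩
      refine ⟨⟨h1, fun x hx => ?_, h3⟩, fun h => ?_⟩
      · exact Finset.union_subset_union_right (Finset.erase_subset _ _) (h2 hx)
      · rcases Finset.mem_union.1 (h2 h) with h | h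
        · exact huA h
        · exact (Finset.notMem_erase u D) h
  · calc _ ≤ ∑ Y ∈ (reachableSets G A D).filter (fun Y => u ∈ Y), R Y :=
        Finset.sum_le_sum fun Y hY => hw Y (Finset.mem_filter.1 hY).1 (Finset.mem_filter.1 hY).2
      _ ≤ _ := by
        refine Finset.sum_le_sum_of_subset_of_nonneg (fun Y hY => ?_) fun Y _ _ => hR Y
        obtain ⟨hY, huY⟩ := Finset.mem_filter.1 hY
        obtain ⟨h1, h2, h3⟩ := hmem.1 hY
        refine hmem.2 ⟨Finset.insert_subset huY h1, fun x hx => ?_,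
          h3.mono (Finset.subset_insert _ _)⟩
        by_cases hxu : x = u
        · simp [hxu]
        · rcases Finset.mem_union.1 (h2 hx) with h | h
          · simp [h]
          · simp [h, hxu]

open Classical in
-- Induction on the undecided set, deciding one vertex at a time. Discarding `u` lowers the energy
-- by its own term; accepting it raises the energy by at most `Δ`, and by a further `cΔ/2` if it
-- becomes a hub. The weights are set so that the branches always recombine through `1 + x ≤ exp x`.
theorem sum_exploreWeight_le [Fintype V] {Δ c : ℕ} {z κ a : ℝ} (hc : 1 ≤ c) (ha : 0 ≤ a)
    (hΔ : ∀ u, degreeIn G Finset.univ u ≤ Δ) (hz : 0 ≤ z) (hκ : 0 ≤ κ) (hκ1 : κ ≤ 1)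
    (hzc : 2 * (z * Real.exp (a * Δ)) ≤ a * c)
    (hκc : ∀ m : ℕ, c ≤ 2 * m → κ ^ m ≤ (c : ℝ)⁻¹ * Real.exp (-(a * (c / 2 * Δ))))
    (A H D : Finset V) (hAD : Disjoint A D) :
    ∑ Y ∈ reachableSets G A D, exploreWeight G c z κ A H Y ≤
      Real.exp (a * energy G c A H D) := by
  induction hn : D.card using Nat.strong_induction_on generalizing A H D with
  | _ n ih =>
  have hmem : ∀ {A D Y}, Y ∈ reachableSets G A D ↔
      A ⊆ Y ∧ Y ⊆ A ∪ D ∧ ReachableFrom G A Y := by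
    intro A D Y; simp [reachableSets]
  have hc0 : (0 : ℝ) < c := by exact_mod_cast hc
  have hw0 := fun A H Y => exploreWeight_nonneg (G := G) (c := c) hz hκ A H Y
  have out : ∀ u ∈ D, ∑ Y ∈ reachableSets G A (D.erase u), exploreWeight G c z κ A H Y ≤
      Real.exp (a * energy G c A H D -
        a * ((degreeIn G A u : ℝ) + c / 2 * degreeIn G H u)) := by
    intro u hu
    refine (ih _ (hn ▸ Finset.card_erase_lt_of_mem hu) A H _
      (hAD.mono_right (Finset.erase_subset _ _)) rfl).trans (Real.exp_le_exp.2 (le_of_eq ?_))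
    rw [energy_erase _ _ _ hu]; ring
  have dis : ∀ u, Disjoint (insert u A) (D.erase u) := fun u => by
    rw [Finset.disjoint_insert_left]
    exact ⟨Finset.notMem_erase _ _, hAD.mono_right (Finset.erase_subset _ _)⟩
  have inn : ∀ u ∈ D, ∑ Y ∈ reachableSets G (insert u A) (D.erase u),
      exploreWeight G c z κ (insert u A) H Y ≤
      Real.exp (a * energy G c A H D -
        a * ((degreeIn G A u : ℝ) + c / 2 * degreeIn G H u) + a * Δ) := by
    intro u hu
    refine (ih _ (hn ▸ Finset.card_erase_lt_of_mem hu) _ H _ (dis u) rfl).trans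
      (Real.exp_le_exp.2 ?_)
    have h1 := energy_insert_le hΔ c A H (D.erase u) u
    rw [energy_erase c A H hu] at h1
    have := mul_le_mul_of_nonneg_left h1 ha
    linarith
  have innhub : ∀ u ∈ D, ∑ Y ∈ reachableSets G (insert u A) (D.erase u),
      exploreWeight G c z κ (insert u A) (insert u H) Y ≤
      Real.exp (a * energy G c A H D -
        a * ((degreeIn G A u : ℝ) + c / 2 * degreeIn G H u) + a * Δ + a * (c / 2 * Δ)) := by
    intro u hu
    refine (ih _ (hn ▸ Finset.card_erase_lt_of_mem hu) _ (insert u H) _ (dis u) rfl).trans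
      (Real.exp_le_exp.2 ?_)
    have h2 := energy_insert_hub_le hΔ c (insert u A) H (D.erase u) u
    have h1 := energy_insert_le hΔ c A H (D.erase u) u
    rw [energy_erase c A H hu] at h1
    have := mul_le_mul_of_nonneg_left (h2.trans (add_le_add h1 le_rfl)) ha
    linarith
  -- A vertex with at least `c / 2` neighbors in `A`, or next to a hub, has energy term at least `c
  -- / 2`. This pays for accepting it without any discount, since `z * exp (aΔ) ≤ a * c / 2`.
  by_cases hrich : ∃ u ∈ D, c ≤ 2 * degreeIn G A u ∨ 0 < degreeIn G H u
  · obtain ⟨u, hu, hr⟩ := hrich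
    have huA : u ∉ A := Finset.disjoint_right.1 hAD hu
    set t := (degreeIn G A u : ℝ) + c / 2 * degreeIn G H u with ht
    have htc : (c : ℝ) / 2 ≤ t := by
      rcases hr with hr | hr
      · have : (c : ℝ) ≤ 2 * degreeIn G A u := by exact_mod_cast hr
        have h0 : (0 : ℝ) ≤ c / 2 * degreeIn G H u := by positivity
        linarith
      · have : (1 : ℝ) ≤ degreeIn G H u := by exact_mod_cast hr
        have h0 : (0 : ℝ) ≤ degreeIn G A u := by positivity
        nlinarith
    refine (sum_reachableSets_le hu (R := fun Y => z * exploreWeight G c z κ (insert u A) H Y)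
      (fun Y => mul_nonneg hz (hw0 _ _ _))
      fun Y _ huY => exploreWeight_le_of_mem hc hz hκ hκ1 huA huY).trans ?_
    rw [← Finset.mul_sum]
    calc _ ≤ Real.exp (a * energy G c A H D - a * t) +
          z * Real.exp (a * energy G c A H D - a * t + a * Δ) :=
          add_le_add (out u hu) (mul_le_mul_of_nonneg_left (inn u hu) hz)
      _ = Real.exp (a * energy G c A H D - a * t) * (1 + z * Real.exp (a * Δ)) := by
          rw [Real.exp_add]; ring
      _ ≤ Real.exp (a * energy G c A H D - a * t) * Real.exp (a * t) := by
          refine mul_le_mul_of_nonneg_left ?_ (Real.exp_pos _).le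
          have h1 := Real.add_one_le_exp (a * t)
          have h2 := mul_le_mul_of_nonneg_left htc ha
          linarith
      _ = _ := by rw [← Real.exp_add]; ring_nf
  push Not at hrich
  -- A poor vertex next to `A` guarantees only energy `1`, so accepting it must come with a discount
  -- `1 / c`: from the low-degree factor, or from the released `κ` factors when it becomes a hub.
  -- The two options together cost at most `a`.
  by_cases hadj : ∃ u ∈ D, 0 < degreeIn G A u
  · obtain ⟨u, hu, hr⟩ := hadj
    have huA : u ∉ A := Finset.disjoint_right.1 hAD hu
    set t := (degreeIn G A u : ℝ) + c / 2 * degreeIn G H u with ht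
    have htc : 1 ≤ t := by
      have : (1 : ℝ) ≤ degreeIn G A u := by exact_mod_cast hr
      have h0 : (0 : ℝ) ≤ c / 2 * degreeIn G H u := by positivity
      linarith
    set b := (c : ℝ)⁻¹ * Real.exp (-(a * (c / 2 * Δ))) with hb
    have hb0 : 0 ≤ b := by positivity
    refine (sum_reachableSets_le hu
      (R := fun Y => z * (c : ℝ)⁻¹ * exploreWeight G c z κ (insert u A) H Y +
        z * b * exploreWeight G c z κ (insert u A) (insert u H) Y)
      (fun Y => add_nonneg (mul_nonneg (by positivity) (hw0 _ _ _))
        (mul_nonneg (by positivity) (hw0 _ _ _))) fun Y hY huY => ?_).trans ?_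
    · obtain ⟨h1, h2, -⟩ := hmem.1 hY
      by_cases hlow : degreeIn G Y u < c
      · exact le_add_of_le_of_nonneg (exploreWeight_le_of_low hz hκ hκ1 huA huY hlow)
          (mul_nonneg (by positivity) (hw0 _ _ _))
      · refine le_add_of_nonneg_of_le (mul_nonneg (by positivity) (hw0 _ _ _)) ?_
        refine exploreWeight_le_of_hub hc hz hκ hκ1 hκc huA h1 huY (not_lt.1 hlow)
          (hrich u hu).1 fun w hw => ?_
        obtain ⟨hwY, hwA⟩ := Finset.mem_sdiff.1 hw
        have hwD := (Finset.mem_union.1 (h2 hwY)).resolve_left hwA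
        exact Nat.le_zero.1 (hrich w hwD).2
    rw [Finset.sum_add_distrib, ← Finset.mul_sum, ← Finset.mul_sum]
    have hee : b * Real.exp (a * (c / 2 * Δ)) = (c : ℝ)⁻¹ := by
      rw [hb, mul_assoc, ← Real.exp_add]; simp
    calc _ ≤ Real.exp (a * energy G c A H D - a * t) +
          (z * (c : ℝ)⁻¹ * Real.exp (a * energy G c A H D - a * t + a * Δ) +
          z * b * Real.exp (a * energy G c A H D - a * t + a * Δ + a * (c / 2 * Δ))) :=
          add_le_add (out u hu) (add_le_add
            (mul_le_mul_of_nonneg_left (inn u hu) (by positivity))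
            (mul_le_mul_of_nonneg_left (innhub u hu) (by positivity)))
      _ = Real.exp (a * energy G c A H D - a * t) * (1 + z * (c : ℝ)⁻¹ * Real.exp (a * Δ) +
            z * Real.exp (a * Δ) * (b * Real.exp (a * (c / 2 * Δ)))) := by
          simp only [Real.exp_add]; ring
      _ = Real.exp (a * energy G c A H D - a * t) *
            (1 + 2 * (z * Real.exp (a * Δ)) * (c : ℝ)⁻¹) := by
          rw [hee]; ring
      _ ≤ Real.exp (a * energy G c A H D - a * t) * Real.exp (a * t) := by
          refine mul_le_mul_of_nonneg_left ?_ (Real.exp_pos _).le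
          have h1 := Real.add_one_le_exp (a * t)
          have h2 := mul_le_mul_of_nonneg_left htc ha
          have h3 : 2 * (z * Real.exp (a * Δ)) * (c : ℝ)⁻¹ ≤ a := by
            rw [← div_eq_mul_inv, div_le_iff₀ hc0]; exact hzc
          linarith
      _ = _ := by rw [← Real.exp_add]; ring_nf
  push Not at hadj
  -- Nothing undecided touches `A`, so the exploration has stopped.
  have hsub : reachableSets G A D ⊆ {A} := by
    intro Y hY
    obtain ⟨h1, h2, h3⟩ := hmem.1 hY
    by_contra hne
    obtain ⟨p, hp, y, hy, hyA, hpy⟩ :=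
      h3 A subset_rfl h1 fun e => hne (Finset.mem_singleton.2 e.symm)
    have hyD := (Finset.mem_union.1 (h2 hy)).resolve_left hyA
    have := degreeIn_pos_of_adj hp hpy.symm
    have := hadj y hyD
    omega
  calc _ ≤ ∑ Y ∈ {A}, exploreWeight G c z κ A H Y :=
        Finset.sum_le_sum_of_subset_of_nonneg hsub fun Y _ _ => hw0 _ _ _
    _ = 1 := by simp [exploreWeight]
    _ ≤ _ := Real.one_le_exp (mul_nonneg ha (energy_nonneg _ _ _ _))

end Exploration

/-! ### From failure of degeneracy to a dense core. -/

section Core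

variable {V : Type*} (G : SimpleGraph V) (f : V → ℕ)

open Classical in
/-- A connected set in which every color is used at least three times and at most as many
vertices as there are colors have degree less than the number of colors. -/
def IsDenseCore (Y : Finset V) : Prop :=
  Y.Nonempty ∧
  (∀ P ⊆ Y, P.Nonempty → P ≠ Y → ∃ p ∈ P, ∃ y ∈ Y, y ∉ P ∧ G.Adj p y) ∧
  (∀ y ∈ Y, 3 ≤ (Y.filter fun x => f x = f y).card) ∧
  (Y.filter fun y => degreeIn G Y y < (Y.image f).card).card ≤ (Y.image f).card

/-- Some color is repeated, and every monochromatic set of at least two vertices has average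
degree at least the number of colors. -/
def HasLargeMonoDegrees (Y : Finset V) : Prop :=
  (∃ x ∈ Y, ∃ y ∈ Y, x ≠ y ∧ f x = f y) ∧
  ∀ A ⊆ Y, (∀ x ∈ A, ∀ y ∈ A, f x = f y) → 2 ≤ A.card →
    A.card * (Y.image f).card ≤ ∑ x ∈ A, degreeIn G Y x

variable {G f}

open Classical in
lemma degreeIn_lt_card {Y : Finset V} {x : V} (hx : x ∈ Y) : degreeIn G Y x < Y.card := by
  refine Finset.card_lt_card ((Finset.ssubset_iff_of_subset (Finset.filter_subset _ _)).2
    ⟨x, hx, by simp⟩)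

open Classical in
-- If some `x₀ ∈ A` sees two vertices of `B`, then an edge from another vertex of `A` to `B` would
-- extend to a bicolored path through `x₀`. So `x₀` carries all edges, at most two. A single vertex
-- can thus lose two neighbors with one color, which is why degrees are averaged over sets of at
-- least two vertices.
lemma sum_degreeIn_le_of_card_le_two (hproper : ∀ x y, G.Adj x y → f x ≠ f y)
    (hpath : ∀ a b c d, [a, b, c, d].Nodup → G.Adj a b → G.Adj b c → G.Adj c d →
      ¬ (f a = f c ∧ f b = f d))
    {A B : Finset V} (hA : ∀ x ∈ A, ∀ y ∈ A, f x = f y) (hB : ∀ x ∈ B, ∀ y ∈ B, f x = f y)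
    (hA2 : 2 ≤ A.card) (hB2 : B.card ≤ 2) : ∑ x ∈ A, degreeIn G B x ≤ A.card := by
  by_cases h1 : ∀ x ∈ A, degreeIn G B x ≤ 1
  · simpa using Finset.sum_le_card_nsmul A _ 1 h1
  push Not at h1
  obtain ⟨x₀, hx₀, hd⟩ := h1
  have hfull : B.filter (fun w => G.Adj x₀ w) = B :=
    Finset.eq_of_subset_of_card_le (Finset.filter_subset _ _) (hB2.trans hd)
  have hadj : ∀ y ∈ B, G.Adj x₀ y := fun y hy => by
    rw [← hfull] at hy; exact (Finset.mem_filter.1 hy).2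
  have hzero : ∀ x ∈ A, x ≠ x₀ → degreeIn G B x = 0 := by
    intro x hx hne
    by_contra h0
    obtain ⟨y, hy⟩ := Finset.card_pos.1 (Nat.pos_of_ne_zero h0)
    obtain ⟨hyB, hxy⟩ := Finset.mem_filter.1 hy
    have hBc : 1 < B.card :=
      lt_of_lt_of_le hd (Finset.card_le_card (Finset.filter_subset _ _))
    obtain ⟨y', hy'B, hyy'⟩ := Finset.exists_mem_ne hBc y
    have hfy : f y = f y' := hB y hyB y' hy'B
    refine hpath x y x₀ y' ?_ hxy (hadj y hyB).symm (hadj y' hy'B) ⟨hA x hx x₀ hx₀, hfy⟩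
    have hxy' : x ≠ y' := fun h => hproper x y hxy (by rw [hfy, h])
    simp [hxy.ne, hne, hxy', (hadj y hyB).ne', hyy'.symm, (hadj y' hy'B).ne]
  rw [Finset.sum_eq_single x₀ hzero fun h => absurd hx₀ h]
  exact (Finset.card_le_card (Finset.filter_subset _ _)).trans (hB2.trans hA2)

open Classical in
lemma degreeIn_eq_sum_colors (Y : Finset V) (K : Finset ℕ) (x : V) :
    degreeIn G (Y.filter fun y => f y ∈ K) x =
      ∑ k ∈ K, degreeIn G (Y.filter fun y => f y = k) x := by
  unfold degreeIn
  rw [Finset.card_eq_sum_card_fiberwise (f := f) (t := K)]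
  · refine Finset.sum_congr rfl fun k hk => ?_
    congr 1
    ext y
    simp only [Finset.mem_filter]
    constructor
    · rintro ⟨⟨⟨h1, h2⟩, h3⟩, h4⟩; exact ⟨⟨h1, h4⟩, h3⟩
    · rintro ⟨⟨h1, h4⟩, h3⟩; exact ⟨⟨⟨h1, h4 ▸ hk⟩, h3⟩, h4⟩
  · intro y hy
    exact (Finset.mem_filter.1 (Finset.mem_filter.1 hy).1).2

open Classical in
lemma sum_degreeIn_colors_le (hproper : ∀ x y, G.Adj x y → f x ≠ f y)
    (hpath : ∀ a b c d, [a, b, c, d].Nodup → G.Adj a b → G.Adj b c → G.Adj c d →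
      ¬ (f a = f c ∧ f b = f d))
    {A Y : Finset V} {K : Finset ℕ} (hA : ∀ x ∈ A, ∀ y ∈ A, f x = f y) (hA2 : 2 ≤ A.card)
    (hK : ∀ k ∈ K, (Y.filter fun y => f y = k).card ≤ 2) :
    ∑ x ∈ A, degreeIn G (Y.filter fun y => f y ∈ K) x ≤ A.card * K.card := by
  simp only [degreeIn_eq_sum_colors]
  rw [Finset.sum_comm, mul_comm]
  refine Finset.sum_le_card_nsmul K _ _ fun k hk => ?_
  refine sum_degreeIn_le_of_card_le_two hproper hpath hA (fun x hx y hy => ?_) hA2 (hK k hk)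
  rw [(Finset.mem_filter.1 hx).2, (Finset.mem_filter.1 hy).2]

open Classical in
/-- Deleting the color classes with at most two vertices preserves large degrees. -/
lemma HasLargeMonoDegrees.delete_small_classes (hproper : ∀ x y, G.Adj x y → f x ≠ f y)
    (hpath : ∀ a b c d, [a, b, c, d].Nodup → G.Adj a b → G.Adj b c → G.Adj c d →
      ¬ (f a = f c ∧ f b = f d))
    {Y : Finset V} (h : HasLargeMonoDegrees G f Y) :
    HasLargeMonoDegrees G f (Y.filter fun y => 3 ≤ (Y.filter fun x => f x = f y).card) := by
  set K := (Y.image f).filter fun k => (Y.filter fun y => f y = k).card ≤ 2 with hKdef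
  have hK2 : ∀ k ∈ K, (Y.filter fun y => f y = k).card ≤ 2 :=
    fun k hk => (Finset.mem_filter.1 hk).2
  set Y' := Y.filter fun y => 3 ≤ (Y.filter fun x => f x = f y).card with hY'
  have hKmem : ∀ y ∈ Y, (f y ∈ K ↔ (Y.filter fun x => f x = f y).card ≤ 2) := by
    intro y hy
    rw [hKdef, Finset.mem_filter]
    exact ⟨fun h => h.2, fun h => ⟨Finset.mem_image_of_mem _ hy, h⟩⟩
  have hsplit : Y \ Y' = Y.filter fun y => f y ∈ K := by
    ext y
    rw [Finset.mem_sdiff, Finset.mem_filter, Finset.mem_filter]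
    constructor
    · rintro ⟨h1, h2⟩
      refine ⟨h1, (hKmem y h1).2 ?_⟩
      by_contra h3
      exact h2 ⟨h1, by omega⟩
    · rintro ⟨h1, h2⟩
      refine ⟨h1, fun h3 => ?_⟩
      have := (hKmem y h1).1 h2
      have := h3.2
      omega
  have himage : Y'.image f = Y.image f \ K := by
    ext k
    simp only [Finset.mem_sdiff, Finset.mem_image]
    constructor
    · rintro ⟨y, hy, rfl⟩
      obtain ⟨hyY, hy3⟩ := Finset.mem_filter.1 hy
      refine ⟨⟨y, hyY, rfl⟩, fun hk => ?_⟩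
      have := (hKmem y hyY).1 hk
      omega
    · rintro ⟨⟨y, hy, rfl⟩, hk⟩
      refine ⟨y, Finset.mem_filter.2 ⟨hy, ?_⟩, rfl⟩
      have := mt (hKmem y hy).2 hk
      omega
  have hcardK : (Y'.image f).card + K.card = (Y.image f).card := by
    rw [himage]
    exact Finset.card_sdiff_add_card_eq_card (Finset.filter_subset _ _)
  obtain ⟨⟨x, hx, x', hx', hne, hfx⟩, hdeg⟩ := h
  refine ⟨?_, ?_⟩
  -- If every class were small, the pair `x, x'` would have degree sum at most `2 (|K| - 1)`:
  -- properness removes their own color from the count. The hypothesis demands twice the number of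
  -- colors.
  · have hnonempty : Y'.Nonempty := by
      by_contra hemp
      rw [Finset.not_nonempty_iff_eq_empty] at hemp
      have hall : ∀ y ∈ Y, f y ∈ K := by
        intro y hy
        rw [hemp, Finset.sdiff_empty] at hsplit
        rw [hsplit] at hy
        exact (Finset.mem_filter.1 hy).2
      have hmono : ∀ a ∈ ({x, x'} : Finset V), f a = f x := by
        intro a ha
        rcases Finset.mem_insert.1 ha with rfl | ha
        · rfl
        · rw [Finset.mem_singleton.1 ha, hfx]
      have hcard : ({x, x'} : Finset V).card = 2 := Finset.card_pair hne
      have h1 := hdeg {x, x'} (by intro a; simp; rintro (rfl | rfl) <;> assumption)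
        (fun a ha b hb => (hmono a ha).trans (hmono b hb).symm) hcard.ge
      have h2 := sum_degreeIn_colors_le hproper hpath (A := {x, x'}) (Y := Y)
        (K := K.erase (f x)) (fun a ha b hb => (hmono a ha).trans (hmono b hb).symm) hcard.ge
        (fun k hk => hK2 k (Finset.mem_of_mem_erase hk))
      have h3 : ∀ a ∈ ({x, x'} : Finset V), degreeIn G Y a ≤
          degreeIn G (Y.filter fun y => f y ∈ K.erase (f x)) a := by
        intro a ha
        refine Finset.card_le_card fun y hy => ?_
        obtain ⟨hyY, hay⟩ := Finset.mem_filter.1 hy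
        refine Finset.mem_filter.2 ⟨Finset.mem_filter.2 ⟨hyY, Finset.mem_erase.2
          ⟨?_, hall y hyY⟩⟩, hay⟩
        rw [← hmono a ha]
        exact (hproper a y hay).symm
      have h4 := Finset.sum_le_sum h3
      have h5 : K.card ≤ (Y.image f).card := by omega
      have h6 : (K.erase (f x)).card + 1 = K.card := Finset.card_erase_add_one (hall x hx)
      rw [hcard] at h1 h2
      omega
    obtain ⟨y, hy⟩ := hnonempty
    have hy3 := (Finset.mem_filter.1 hy).2
    obtain ⟨y', hy', hyy'⟩ := Finset.exists_mem_ne (lt_of_lt_of_le (by norm_num) hy3) y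
    obtain ⟨hy'Y, hfy⟩ := Finset.mem_filter.1 hy'
    refine ⟨y, hy, y', Finset.mem_filter.2 ⟨hy'Y, ?_⟩, hyy'.symm, hfy.symm⟩
    rw [hfy]; exact hy3
  · intro A hA hmono hA2
    have h1 := hdeg A (hA.trans (Finset.filter_subset _ _)) hmono hA2
    have h2 := sum_degreeIn_colors_le hproper hpath (A := A) (Y := Y) (K := K) hmono hA2 hK2
    rw [← hsplit] at h2
    have h3 : ∑ a ∈ A, degreeIn G Y a =
        ∑ a ∈ A, degreeIn G Y' a + ∑ a ∈ A, degreeIn G (Y \ Y') a := by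
      rw [← Finset.sum_add_distrib]
      exact Finset.sum_congr rfl fun a _ => degreeIn_eq_add_sdiff (Finset.filter_subset _ _) a
    rw [← hcardK, mul_add] at h1
    omega

open Classical in
/-- A union of components containing a repeated color inherits large degrees. -/
lemma HasLargeMonoDegrees.of_closed {P Y : Finset V} (h : HasLargeMonoDegrees G f Y)
    (hPY : P ⊆ Y) (hP : ∀ p ∈ P, degreeIn G P p = degreeIn G Y p)
    (hrep : ∃ x ∈ P, ∃ y ∈ P, x ≠ y ∧ f x = f y) : HasLargeMonoDegrees G f P := by
  refine ⟨hrep, fun A hA hmono hA2 => ?_⟩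
  calc A.card * (P.image f).card ≤ A.card * (Y.image f).card :=
        Nat.mul_le_mul_left _ (Finset.card_le_card (Finset.image_subset_image hPY))
    _ ≤ ∑ x ∈ A, degreeIn G Y x := h.2 A (hA.trans hPY) hmono hA2
    _ = _ := Finset.sum_congr rfl fun a ha => (hP a (hA ha)).symm

open Classical in
-- In a union of components without repeated colors there are as many vertices as colors, and a
-- degree is smaller than the number of vertices.
lemma degreeIn_lt_of_rainbow {P Y : Finset V} (hPY : P ⊆ Y)
    (hP : ∀ p ∈ P, degreeIn G P p = degreeIn G Y p)
    (hrep : ¬ ∃ x ∈ P, ∃ y ∈ P, x ≠ y ∧ f x = f y) {x : V} (hx : x ∈ P) :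
    degreeIn G Y x < (Y.image f).card := by
  have hinj : Set.InjOn f P := by
    intro a ha b hb hab
    by_contra hne
    exact hrep ⟨a, ha, b, hb, hne, hab⟩
  calc degreeIn G Y x = degreeIn G P x := (hP x hx).symm
    _ < P.card := degreeIn_lt_card hx
    _ = (P.image f).card := (Finset.card_image_of_injOn hinj).symm
    _ ≤ _ := Finset.card_le_card (Finset.image_subset_image hPY)

open Classical in
lemma HasLargeMonoDegrees.two_mul_le {Y : Finset V} (h : HasLargeMonoDegrees G f Y) {x y : V}
    (hx : x ∈ Y) (hy : y ∈ Y) (hne : x ≠ y) (hf : f x = f y) :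
    2 * (Y.image f).card ≤ degreeIn G Y x + degreeIn G Y y := by
  have := h.2 {x, y} (by intro a; simp; rintro (rfl | rfl) <;> assumption)
    (by intro a ha b hb; simp at ha hb; rcases ha with rfl | rfl <;> rcases hb with rfl | rfl <;>
      simp [hf]) (Finset.card_pair hne).ge
  rwa [Finset.card_pair hne, Finset.sum_pair hne] at this

open Classical in
/-- A star coloring in which some set has large degrees contains a dense core. -/
theorem HasLargeMonoDegrees.exists_isDenseCore (hproper : ∀ x y, G.Adj x y → f x ≠ f y)
    (hpath : ∀ a b c d, [a, b, c, d].Nodup → G.Adj a b → G.Adj b c → G.Adj c d →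
      ¬ (f a = f c ∧ f b = f d))
    (Y : Finset V) (h : HasLargeMonoDegrees G f Y) : ∃ Z ⊆ Y, IsDenseCore G f Z := by
  induction Y using Finset.strongInduction with
  | H Y ih =>
  have step : ∀ P ⊂ Y, HasLargeMonoDegrees G f P → ∃ Z ⊆ Y, IsDenseCore G f Z := by
    intro P hP hPd
    obtain ⟨Z, hZ, hZc⟩ := ih P hP hPd
    exact ⟨Z, hZ.trans hP.1, hZc⟩
  by_cases h3 : ∀ y ∈ Y, 3 ≤ (Y.filter fun x => f x = f y).card
  swap
  · refine step _ ?_ (h.delete_small_classes hproper hpath)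
    refine Finset.filter_ssubset.2 ?_
    push Not at h3 ⊢
    exact h3
  obtain ⟨x, hx, y, hy, hne, hfxy⟩ := h.1
  by_cases hconn : ∀ P ⊆ Y, P.Nonempty → P ≠ Y → ∃ p ∈ P, ∃ y ∈ Y, y ∉ P ∧ G.Adj p y
  · refine ⟨Y, subset_rfl, ⟨x, hx⟩, hconn, h3, ?_⟩
    -- Two low-degree vertices of one color would violate the averaged condition on that pair, so
    -- each color has at most one.
    refine Finset.card_le_card_of_injOn f (fun a ha => ?_) ?_
    · exact Finset.mem_image_of_mem _ (Finset.mem_filter.1 ha).1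
    · intro a ha b hb hab
      by_contra hne
      obtain ⟨ha1, ha2⟩ := Finset.mem_filter.1 ha
      obtain ⟨hb1, hb2⟩ := Finset.mem_filter.1 hb
      have := h.two_mul_le ha1 hb1 hne hab
      omega
  push Not at hconn
  obtain ⟨P, hPY, hPne, hPneY, hnoadj⟩ := hconn
  have hP : ∀ p ∈ P, degreeIn G P p = degreeIn G Y p := by
    intro p hp
    unfold degreeIn
    congr 1
    ext w
    simp only [Finset.mem_filter]
    refine ⟨fun hw => ⟨hPY hw.1, hw.2⟩, fun hw => ⟨?_, hw.2⟩⟩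
    by_contra hwP
    exact hnoadj p hp w hw.1 hwP hw.2
  have hQ : ∀ q ∈ Y \ P, degreeIn G (Y \ P) q = degreeIn G Y q := by
    intro q hq
    obtain ⟨hqY, hqP⟩ := Finset.mem_sdiff.1 hq
    unfold degreeIn
    congr 1
    ext w
    simp only [Finset.mem_filter, Finset.mem_sdiff]
    refine ⟨fun hw => ⟨hw.1.1, hw.2⟩, fun hw => ⟨⟨hw.1, fun hwP => ?_⟩, hw.2⟩⟩
    exact hnoadj w hwP q hqY hqP hw.2.symm
  by_cases hrP : ∃ x ∈ P, ∃ y ∈ P, x ≠ y ∧ f x = f y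
  · exact step P (Finset.ssubset_iff_subset_ne.2 ⟨hPY, hPneY⟩) (h.of_closed hPY hP hrP)
  by_cases hrQ : ∃ x ∈ Y \ P, ∃ y ∈ Y \ P, x ≠ y ∧ f x = f y
  · exact step _ (Finset.sdiff_ssubset hPY hPne) (h.of_closed Finset.sdiff_subset hQ hrQ)
  -- With both sides of the split rainbow, all degrees fall below the number of colors, against the
  -- bound for the repeated pair `x, y`.
  have hlt : ∀ z ∈ Y, degreeIn G Y z < (Y.image f).card := by
    intro z hz
    by_cases hzP : z ∈ P
    · exact degreeIn_lt_of_rainbow hPY hP hrP hzP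
    · exact degreeIn_lt_of_rainbow Finset.sdiff_subset hQ hrQ (Finset.mem_sdiff.2 ⟨hz, hzP⟩)
  have := h.two_mul_le hx hy hne hfxy
  have := hlt x hx
  have := hlt y hy
  omega

open Classical in
/-- A star coloring without dense cores is degenerate. -/
theorem isDegenerateColoring_of_forall_not_isDenseCore [Fintype V]
    (hproper : ∀ x y, G.Adj x y → f x ≠ f y)
    (hpath : ∀ a b c d, [a, b, c, d].Nodup → G.Adj a b → G.Adj b c → G.Adj c d →
      ¬ (f a = f c ∧ f b = f d))
    (hcore : ∀ Y, ¬ IsDenseCore G f Y) : IsDegenerateColoring G f := by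
  intro k hk S _ hSk H hH
  by_contra hcon
  push Not at hcon
  set W : Finset V := Finset.univ.filter fun v => ∃ h : f v ∈ S, (⟨v, h⟩ : {v | f v ∈ S}) ∈ H.verts
    with hW
  have hWim : W.image f ⊆ S := by
    intro k hk
    obtain ⟨v, hv, rfl⟩ := Finset.mem_image.1 hk
    exact (Finset.mem_filter.1 hv).2.1
  have hWc : (W.image f).card ≤ k := hSk ▸ Finset.card_le_card hWim
  have hdeg : ∀ v ∈ W, k ≤ degreeIn G W v := by
    intro v hv
    obtain ⟨hvS, hvH⟩ := (Finset.mem_filter.1 hv).2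
    have h1 := hcon _ hvH
    have h2 : (H.neighborSet ⟨v, hvS⟩).encard ≤
        ((W.filter fun w => G.Adj v w : Finset V) : Set V).encard := by
      rw [← Function.Injective.encard_image Subtype.val_injective]
      refine Set.encard_le_encard ?_
      rintro _ ⟨⟨w, hwS⟩, hw, rfl⟩
      have hadj : G.Adj v w := by simpa using H.adj_sub hw
      simp only [Finset.coe_filter, Set.mem_ofPred_eq, hW, Finset.mem_filter, Finset.mem_univ,
        true_and]
      exact ⟨⟨hwS, H.edge_vert hw.symm⟩, hadj⟩
    rw [Set.encard_coe_eq_coe_finsetCard] at h2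
    exact_mod_cast h1.trans h2
  -- `W` has minimum degree at least `k` but at most `k` colors; a rainbow `W` would have too few
  -- vertices for that degree.
  have hlarge : HasLargeMonoDegrees G f W := by
    refine ⟨?_, fun A hA _ _ => ?_⟩
    · obtain ⟨⟨v, hvS⟩, hv⟩ := hH
      have hvW : v ∈ W := Finset.mem_filter.2 ⟨Finset.mem_univ _, hvS, hv⟩
      by_contra hrep
      have := degreeIn_lt_of_rainbow (G := G) (f := f) (subset_refl W) (fun _ _ => rfl) hrep hvW
      have := hdeg v hvW
      omega
    · rw [← smul_eq_mul]
      exact Finset.card_nsmul_le_sum _ _ _ fun a ha => hWc.trans (hdeg a (hA ha))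
  obtain ⟨Z, -, hZ⟩ := hlarge.exists_isDenseCore hproper hpath
  exact hcore Z hZ

end Core

/-! ### The hereditary property maintained by the count. -/

section Good

variable {V : Type*} (G : SimpleGraph V)

/-- `f` is proper on `S`, has no bicolored path on four vertices and no dense core inside `S`,
and distinguishes the neighbors in `S` of every vertex satisfying `small`. -/
def IsGoodOn (small : V → Prop) (S : Finset V) (f : V → ℕ) : Prop :=
  (∀ x ∈ S, ∀ y ∈ S, G.Adj x y → f x ≠ f y) ∧
  (∀ a ∈ S, ∀ b ∈ S, ∀ c ∈ S, ∀ d ∈ S, [a, b, c, d].Nodup → G.Adj a b → G.Adj b c →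
    G.Adj c d → ¬ (f a = f c ∧ f b = f d)) ∧
  (∀ u, small u → ∀ x ∈ S, ∀ y ∈ S, G.Adj u x → G.Adj u y → x ≠ y → f x ≠ f y) ∧
  ∀ Y ⊆ S, ¬ IsDenseCore G f Y

variable {G} {small : V → Prop}

lemma IsDenseCore.congr {f g : V → ℕ} {Y : Finset V} (h : IsDenseCore G f Y)
    (hfg : ∀ y ∈ Y, f y = g y) : IsDenseCore G g Y := by
  classical
  obtain ⟨h1, h2, h3, h4⟩ := h
  have himage : Y.image g = Y.image f := Finset.image_congr fun y hy => (hfg y hy).symm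
  refine ⟨h1, h2, fun y hy => ?_, by rw [himage]; convert h4⟩
  convert h3 y hy using 2
  refine Finset.filter_congr fun x hx => ?_
  rw [hfg x hx, hfg y hy]

lemma IsGoodOn.mono {S T : Finset V} {f : V → ℕ} (hST : S ⊆ T) (h : IsGoodOn G small T f) :
    IsGoodOn G small S f :=
  ⟨fun x hx y hy => h.1 x (hST hx) y (hST hy),
    fun a ha b hb c hc d hd => h.2.1 a (hST ha) b (hST hb) c (hST hc) d (hST hd),
    fun u hu x hx y hy => h.2.2.1 u hu x (hST hx) y (hST hy),
    fun Y hY => h.2.2.2 Y (hY.trans hST)⟩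

lemma IsGoodOn.congr {S : Finset V} {f g : V → ℕ} (hfg : ∀ u ∈ S, f u = g u)
    (h : IsGoodOn G small S f) : IsGoodOn G small S g := by
  refine ⟨fun x hx y hy => ?_, fun a ha b hb c hc d hd => ?_, fun u hu x hx y hy => ?_,
    fun Y hY hYc => h.2.2.2 Y hY (hYc.congr fun y hy => (hfg y (hY hy)).symm)⟩
  · rw [← hfg x hx, ← hfg y hy]; exact h.1 x hx y hy
  · rw [← hfg a ha, ← hfg b hb, ← hfg c hc, ← hfg d hd]; exact h.2.1 a ha b hb c hc d hd
  · rw [← hfg x hx, ← hfg y hy]; exact h.2.2.1 u hu x hx y hy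

lemma isGoodOn_empty (f : V → ℕ) : IsGoodOn G small ∅ f := by
  refine ⟨by simp, by simp, by simp, fun Y hY hYc => ?_⟩
  obtain ⟨y, hy⟩ := hYc.1
  simpa using hY hy

end Good

/-! ### Patterns that witness a bad extension. -/

section Patterns

variable {V : Type*} [Fintype V] (G : SimpleGraph V) (small : V → Prop)

open Classical in
/-- The neighbors of a vertex. -/
noncomputable def nbrs (v : V) : Finset V := Finset.univ.filter fun w => G.Adj v w

open Classical in
/-- Patterns in which the color of `v` is that of a neighbor. -/
noncomputable def edgePatterns (v : V) : Finset (Finset V × (V → V)) :=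
  (nbrs G v).image fun w => ({v}, fun _ => w)

open Classical in
/-- Patterns in which the color of `v` is repeated around a small vertex. -/
noncomputable def smallPatterns (v : V) : Finset (Finset V × (V → V)) :=
  ((nbrs G v).filter small).biUnion fun u => (nbrs G u).image fun w => ({v}, fun _ => w)

open Classical in
/-- The pattern of a bicolored path `a b c d`. -/
noncomputable def pathPattern (a b c d : V) : Finset V × (V → V) :=
  ({a, b}, fun u => if u = a then c else d)

open Classical in
/-- Patterns of bicolored paths in which `v` is the first or the second vertex. -/
noncomputable def pathPatterns (v : V) : Finset (Finset V × (V → V)) :=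
  ((nbrs G v).biUnion fun b => (nbrs G b).biUnion fun c =>
      (nbrs G c).image fun d => pathPattern v b c d) ∪
    ((nbrs G v).biUnion fun a => (nbrs G v).biUnion fun c =>
      (nbrs G c).image fun d => pathPattern a v c d)

open Classical in
/-- The sets containing `v` that can be dense cores with `c` colors. -/
noncomputable def coreSets (c : ℕ) (v : V) : Finset (Finset V) :=
  Finset.univ.filter fun Y => v ∈ Y ∧
    (∀ P ⊆ Y, P.Nonempty → P ≠ Y → ∃ p ∈ P, ∃ y ∈ Y, y ∉ P ∧ G.Adj p y) ∧
    3 * c ≤ Y.card ∧ (Y.filter fun y => degreeIn G Y y < c).card ≤ c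

open Classical in
/-- Patterns coloring `Y` with the colors of `c` representatives. -/
noncomputable def colorPatterns (c : ℕ) (Y : Finset V) : Finset (Finset V × (V → V)) :=
  (Y.powerset.filter fun U => U.card + c = Y.card).biUnion fun U =>
    (Fintype.piFinset fun u => if u ∈ U then Y \ U else {u}).image fun φ => (U, φ)

open Classical in
/-- Patterns of dense cores. -/
noncomputable def corePatterns (v : V) : Finset (Finset V × (V → V)) :=
  (Finset.range (Fintype.card V)).biUnion fun i =>
    (coreSets G (i + 1) v).biUnion fun Y => colorPatterns (i + 1) Y

variable {G small}

lemma mem_nbrs {v w : V} : w ∈ nbrs G v ↔ G.Adj v w := by simp [nbrs]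

open Classical in
-- Choose in each color class a representative different from `v`, possible because classes have at
-- least three vertices. The remaining vertices of `Y`, including `v`, copy their representatives.
lemma IsDenseCore.exists_pattern {S Y : Finset V} {v : V} {f : V → ℕ}
    (h : IsDenseCore G f Y) (hY : Y ⊆ S) (hvY : v ∈ Y) :
    ∃ p ∈ corePatterns G v, v ∈ p.1 ∧ p.1 ⊆ S ∧
        ∀ u ∈ p.1, p.2 u ∈ S ∧ p.2 u ∉ p.1 ∧ f u = f (p.2 u) := by
  obtain ⟨hne, hconn, h3, hlow⟩ := h
  set c := (Y.image f).card with hc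
  have hex : ∀ k : ℕ, ∃ w : V, k ∈ Y.image f → w ∈ Y ∧ f w = k ∧ w ≠ v := by
    intro k
    by_cases hk : k ∈ Y.image f
    · obtain ⟨y, hy, rfl⟩ := Finset.mem_image.1 hk
      obtain ⟨w, hw, hwv⟩ := Finset.exists_mem_ne
        (lt_of_lt_of_le (by norm_num) (h3 y hy)) v
      obtain ⟨hwY, hfw⟩ := Finset.mem_filter.1 hw
      exact ⟨w, fun _ => ⟨hwY, hfw, hwv⟩⟩
    · exact ⟨v, fun h => absurd h hk⟩
  choose g hg using hex
  have hgY : ∀ y ∈ Y, g (f y) ∈ Y ∧ f (g (f y)) = f y ∧ g (f y) ≠ v :=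
    fun y hy => hg _ (Finset.mem_image_of_mem f hy)
  set R := (Y.image f).image g with hR
  have hRY : R ⊆ Y := by
    intro r hr
    obtain ⟨k, hk, rfl⟩ := Finset.mem_image.1 hr
    exact (hg k hk).1
  have hRc : R.card = c := by
    refine Finset.card_image_of_injOn fun k hk l hl hkl => ?_
    rw [← (hg k hk).2.1, ← (hg l hl).2.1, hkl]
  have hmemR : ∀ y ∈ Y, g (f y) ∈ R := fun y hy =>
    Finset.mem_image_of_mem g (Finset.mem_image_of_mem f hy)
  have hvR : v ∉ R := by
    intro hv
    obtain ⟨k, hk, hkv⟩ := Finset.mem_image.1 hv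
    exact (hg k hk).2.2 hkv
  have hc1 : 1 ≤ c := Finset.card_pos.2 (hne.image f)
  have hcV : c ≤ Fintype.card V := Finset.card_image_le.trans (Finset.card_le_univ _)
  refine ⟨(Y \ R, fun u => if u ∈ Y \ R then g (f u) else u), ?_,
    Finset.mem_sdiff.2 ⟨hvY, hvR⟩, Finset.sdiff_subset.trans hY, fun u hu => ?_⟩
  -- `corePatterns` indexes the number of colors as `i + 1`, so that it is never zero.
  · refine Finset.mem_biUnion.2 ⟨c - 1, Finset.mem_range.2 (by omega), ?_⟩
    rw [Nat.sub_add_cancel hc1]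
    refine Finset.mem_biUnion.2 ⟨Y, ?_, ?_⟩
    · refine Finset.mem_filter.2 ⟨Finset.mem_univ _, hvY, hconn, ?_, hlow⟩
      refine Finset.mul_card_image_le_card _ _ fun k hk => ?_
      obtain ⟨y, hy, rfl⟩ := Finset.mem_image.1 hk
      exact h3 y hy
    · refine Finset.mem_biUnion.2 ⟨Y \ R, ?_, Finset.mem_image.2 ⟨_, ?_, rfl⟩⟩
      · refine Finset.mem_filter.2 ⟨Finset.mem_powerset.2 Finset.sdiff_subset, ?_⟩
        rw [← hRc]
        exact Finset.card_sdiff_add_card_eq_card hRY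
      · refine Fintype.mem_piFinset.2 fun u => ?_
        by_cases hu : u ∈ Y \ R
        · simp only [if_pos hu]
          have huY := (Finset.mem_sdiff.1 hu).1
          rw [Finset.sdiff_sdiff_eq_self hRY]
          exact hmemR u huY
        · simp only [if_neg hu, Finset.mem_singleton]
  · have huY := (Finset.mem_sdiff.1 hu).1
    simp only [if_pos hu]
    exact ⟨hY (hgY u huY).1, fun h => (Finset.mem_sdiff.1 h).2 (hmemR u huY), (hgY u huY).2.1.symm⟩

open Classical in
lemma exists_pathPattern {S : Finset V} {v : V} {f : V → ℕ} {a b c d : V}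
    (ha : a ∈ S) (hb : b ∈ S) (hc : c ∈ S) (hd : d ∈ S) (hnd : [a, b, c, d].Nodup)
    (hab : G.Adj a b) (hbc : G.Adj b c) (hcd : G.Adj c d) (hac : f a = f c) (hbd : f b = f d)
    (hv : v = a ∨ v = b) :
    ∃ p ∈ pathPatterns G v, v ∈ p.1 ∧ p.1 ⊆ S ∧
        ∀ u ∈ p.1, p.2 u ∈ S ∧ p.2 u ∉ p.1 ∧ f u = f (p.2 u) := by
  simp only [List.nodup_cons, List.mem_cons, List.not_mem_nil, or_false, not_or] at hnd
  obtain ⟨⟨h1, h2, h3⟩, ⟨h4, h5⟩, h6, -⟩ := hnd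
  refine ⟨pathPattern a b c d, ?_, ?_, ?_, ?_⟩
  · rcases hv with rfl | rfl
    · refine Finset.mem_union_left _ (Finset.mem_biUnion.2 ⟨b, mem_nbrs.2 hab,
        Finset.mem_biUnion.2 ⟨c, mem_nbrs.2 hbc, Finset.mem_image.2 ⟨d, mem_nbrs.2 hcd, rfl⟩⟩⟩)
    · refine Finset.mem_union_right _ (Finset.mem_biUnion.2 ⟨a, mem_nbrs.2 hab.symm,
        Finset.mem_biUnion.2 ⟨c, mem_nbrs.2 hbc, Finset.mem_image.2 ⟨d, mem_nbrs.2 hcd, rfl⟩⟩⟩)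
  · rcases hv with rfl | rfl <;> simp [pathPattern]
  · intro x hx
    simp only [pathPattern, Finset.mem_insert, Finset.mem_singleton] at hx
    rcases hx with rfl | rfl <;> assumption
  · intro u hu
    simp only [pathPattern, Finset.mem_insert, Finset.mem_singleton] at hu ⊢
    rcases hu with rfl | rfl
    · simp only [if_true]
      exact ⟨hc, fun h => h.elim (fun h => h2 h.symm) (fun h => h4 h.symm), hac⟩
    · simp only [if_neg (Ne.symm h1)]
      exact ⟨hd, fun h => h.elim (fun h => h3 h.symm) (fun h => h5 h.symm), hbd⟩

open Classical in
variable (G small) in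
/-- All patterns around `v`. -/
noncomputable def badPatterns (v : V) : Finset (Finset V × (V → V)) :=
  (edgePatterns G v ∪ smallPatterns G small v) ∪ (pathPatterns G v ∪ corePatterns G v)

open Classical in
-- Every obstruction inside `insert v S` must use `v`, since `S` itself is good; each kind then
-- yields a pattern containing `v`.
lemma exists_badPattern {S : Finset V} {v : V} {f : V → ℕ}
    (hS : IsGoodOn G small S f) (hbad : ¬ IsGoodOn G small (insert v S) f) :
    ∃ p ∈ badPatterns G small v, v ∈ p.1 ∧ p.1 ⊆ insert v S ∧
        ∀ u ∈ p.1, p.2 u ∈ insert v S ∧ p.2 u ∉ p.1 ∧ f u = f (p.2 u) := by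
  by_contra hno
  push Not at hno
  have single : ∀ w ∈ S, w ≠ v → ({v}, fun _ => w) ∈ badPatterns G small v → f v ≠ f w := by
    intro w hw hwv hmem hf
    obtain ⟨u, hu, h⟩ := hno _ hmem (by simp) (by simp)
    rw [Finset.mem_singleton] at hu
    subst hu
    exact h (Finset.mem_insert_of_mem hw) (by simpa using hwv) hf
  have four : ∀ p ∈ pathPatterns G v, p ∈ badPatterns G small v := fun p hp =>
    Finset.mem_union_right _ (Finset.mem_union_left _ hp)
  refine hbad ⟨?_, ?_, ?_, ?_⟩
  · have key : ∀ w ∈ S, G.Adj v w → f v ≠ f w := fun w hw hvw =>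
      single w hw hvw.ne' (Finset.mem_union_left _ (Finset.mem_union_left _
        (Finset.mem_image.2 ⟨w, mem_nbrs.2 hvw, rfl⟩)))
    intro x hx y hy hxy
    rcases Finset.mem_insert.1 hx with rfl | hx'
    · rcases Finset.mem_insert.1 hy with rfl | hy
      · exact absurd hxy (G.loopless.irrefl _)
      · exact key y hy hxy
    · rcases Finset.mem_insert.1 hy with rfl | hy
      · exact (key x hx' hxy.symm).symm
      · exact hS.1 x hx' y hy hxy
  · intro a ha b hb c hc d hd hnd hab hbc hcd ⟨hac, hbd⟩
    by_cases hv : v = a ∨ v = b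
    · obtain ⟨p, hp, h1, h2, h3⟩ := exists_pathPattern ha hb hc hd hnd hab hbc hcd hac hbd hv
      obtain ⟨u, hu, h⟩ := hno p (four p hp) h1 h2
      exact h (h3 u hu).1 (h3 u hu).2.1 (h3 u hu).2.2
    -- Reversing the path moves `v` into one of the first two positions.
    by_cases hv' : v = d ∨ v = c
    · obtain ⟨p, hp, h1, h2, h3⟩ := exists_pathPattern hd hc hb ha
        (by simpa using List.nodup_reverse.2 hnd) hcd.symm hbc.symm
        hab.symm hbd.symm hac.symm hv'
      obtain ⟨u, hu, h⟩ := hno p (four p hp) h1 h2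
      exact h (h3 u hu).1 (h3 u hu).2.1 (h3 u hu).2.2
    push Not at hv hv'
    exact hS.2.1 a ((Finset.mem_insert.1 ha).resolve_left hv.1.symm)
      b ((Finset.mem_insert.1 hb).resolve_left hv.2.symm)
      c ((Finset.mem_insert.1 hc).resolve_left hv'.2.symm)
      d ((Finset.mem_insert.1 hd).resolve_left hv'.1.symm) hnd hab hbc hcd ⟨hac, hbd⟩
  · have key : ∀ u, small u → ∀ w ∈ S, G.Adj u v → G.Adj u w → w ≠ v → f v ≠ f w :=
      fun u hu w hw huv huw hwv => single w hw hwv (Finset.mem_union_left _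
        (Finset.mem_union_right _ (Finset.mem_biUnion.2 ⟨u, Finset.mem_filter.2
          ⟨mem_nbrs.2 huv.symm, hu⟩, Finset.mem_image.2 ⟨w, mem_nbrs.2 huw, rfl⟩⟩)))
    intro u hu x hx y hy hux huy hxy
    rcases Finset.mem_insert.1 hx with rfl | hx'
    · rcases Finset.mem_insert.1 hy with rfl | hy
      · exact absurd rfl hxy
      · exact key u hu y hy hux huy hxy.symm
    · rcases Finset.mem_insert.1 hy with rfl | hy
      · exact (key u hu x hx' huy hux hxy).symm
      · exact hS.2.2.1 u hu x hx' y hy hux huy hxy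
  · intro Y hY hcore
    by_cases hvY : v ∈ Y
    · obtain ⟨p, hp, h1, h2, h3⟩ := hcore.exists_pattern hY hvY
      obtain ⟨u, hu, h⟩ := hno p (Finset.mem_union_right _ (Finset.mem_union_right _ hp)) h1 h2
      exact h (h3 u hu).1 (h3 u hu).2.1 (h3 u hu).2.2
    · refine hS.2.2.2 Y (fun y hy => ?_) hcore
      exact (Finset.mem_insert.1 (hY hy)).resolve_left fun h => hvY (h ▸ hy)

end Patterns

lemma sum_union_le_of_nonneg {α : Type*} [DecidableEq α] (s t : Finset α) {g : α → ℝ}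
    (hg : ∀ x, 0 ≤ g x) : ∑ x ∈ s ∪ t, g x ≤ ∑ x ∈ s, g x + ∑ x ∈ t, g x := by
  rw [← Finset.sum_union_inter]
  exact le_add_of_nonneg_right (Finset.sum_nonneg fun x _ => hg x)

lemma sum_biUnion_le_of_nonneg {ι α : Type*} [DecidableEq α] (s : Finset ι) (t : ι → Finset α)
    {g : α → ℝ} (hg : ∀ x, 0 ≤ g x) : ∑ x ∈ s.biUnion t, g x ≤ ∑ i ∈ s, ∑ x ∈ t i, g x := by
  classical
  induction s using Finset.induction_on with
  | empty => simp
  | insert i s hi ih =>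
    rw [Finset.biUnion_insert, Finset.sum_insert hi]
    exact (sum_union_le_of_nonneg _ _ hg).trans (add_le_add le_rfl ih)

/-! ### Total weight of the patterns at a vertex. -/

section Weights

variable {V : Type*} [Fintype V] {G : SimpleGraph V} {small : V → Prop} {Δ : ℕ}

lemma card_nbrs_le (hΔ : ∀ u, degreeIn G Finset.univ u ≤ Δ) (v : V) : (nbrs G v).card ≤ Δ := hΔ v

lemma sum_edgePatterns_le (hΔ : ∀ u, degreeIn G Finset.univ u ≤ Δ) (β : ℝ) (v : V) :
    ∑ p ∈ edgePatterns G v, (β ^ (p.1.card - 1))⁻¹ ≤ Δ := by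
  classical
  have h1 : (edgePatterns G v).card ≤ Δ := Finset.card_image_le.trans (card_nbrs_le hΔ v)
  calc _ ≤ (edgePatterns G v).card • (1 : ℝ) := by
        refine Finset.sum_le_card_nsmul _ _ _ fun p hp => ?_
        obtain ⟨w, -, rfl⟩ := Finset.mem_image.1 hp
        simp
    _ ≤ Δ := by rw [nsmul_one]; exact_mod_cast h1

lemma sum_smallPatterns_le (hΔ : ∀ u, degreeIn G Finset.univ u ≤ Δ) {s : ℝ} (hs : 0 ≤ s)
    (hsmall : ∀ u, small u → (degreeIn G Finset.univ u : ℝ) ≤ s) (β : ℝ) (v : V) :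
    ∑ p ∈ smallPatterns G small v, (β ^ (p.1.card - 1))⁻¹ ≤ Δ * s := by
  classical
  have hfloor : ∀ u ∈ (nbrs G v).filter small, (nbrs G u).card ≤ ⌊s⌋₊ := fun u hu =>
    Nat.le_floor (hsmall u (Finset.mem_filter.1 hu).2)
  have h1 : (smallPatterns G small v).card ≤ Δ * ⌊s⌋₊ := by
    refine (Finset.card_biUnion_le_card_mul _ _ _ fun u hu =>
      Finset.card_image_le.trans (hfloor u hu)).trans (Nat.mul_le_mul_right _ ?_)
    exact (Finset.card_le_card (Finset.filter_subset _ _)).trans (card_nbrs_le hΔ v)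
  calc _ ≤ (smallPatterns G small v).card • (1 : ℝ) := by
        refine Finset.sum_le_card_nsmul _ _ _ fun p hp => ?_
        obtain ⟨u, -, hp⟩ := Finset.mem_biUnion.1 hp
        obtain ⟨w, -, rfl⟩ := Finset.mem_image.1 hp
        simp
    _ ≤ Δ * (⌊s⌋₊ : ℝ) := by rw [nsmul_one]; exact_mod_cast h1
    _ ≤ _ := mul_le_mul_of_nonneg_left (Nat.floor_le hs) (by positivity)

lemma sum_pathPatterns_le (hΔ : ∀ u, degreeIn G Finset.univ u ≤ Δ) {β : ℝ} (hβ : 0 < β) (v : V) :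
    ∑ p ∈ pathPatterns G v, (β ^ (p.1.card - 1))⁻¹ ≤ 2 * (Δ : ℝ) ^ 3 * β⁻¹ := by
  classical
  have hn := card_nbrs_le (G := G) hΔ
  have h1 : (pathPatterns G v).card ≤ Δ * (Δ * Δ) + Δ * (Δ * Δ) := by
    refine (Finset.card_union_le _ _).trans (Nat.add_le_add ?_ ?_)
    · refine (Finset.card_biUnion_le_card_mul _ _ (Δ * Δ) fun b _ => ?_).trans
        (Nat.mul_le_mul_right _ (hn v))
      refine (Finset.card_biUnion_le_card_mul _ _ Δ fun c _ => ?_).trans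
        (Nat.mul_le_mul_right _ (hn b))
      exact Finset.card_image_le.trans (hn c)
    · refine (Finset.card_biUnion_le_card_mul _ _ (Δ * Δ) fun b _ => ?_).trans
        (Nat.mul_le_mul_right _ (hn v))
      refine (Finset.card_biUnion_le_card_mul _ _ Δ fun c _ => ?_).trans
        (Nat.mul_le_mul_right _ (hn v))
      exact Finset.card_image_le.trans (hn c)
  have hw : ∀ a b c d : V, G.Adj a b → (β ^ ((pathPattern a b c d).1.card - 1))⁻¹ ≤ β⁻¹ := by
    intro a b c d hab
    rw [pathPattern, Finset.card_pair hab.ne]; simp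
  calc _ ≤ (pathPatterns G v).card • β⁻¹ := by
        refine Finset.sum_le_card_nsmul _ _ _ fun p hp => ?_
        rcases Finset.mem_union.1 hp with hp | hp
        · obtain ⟨b, hb, hp⟩ := Finset.mem_biUnion.1 hp
          obtain ⟨c, -, hp⟩ := Finset.mem_biUnion.1 hp
          obtain ⟨d, -, rfl⟩ := Finset.mem_image.1 hp
          exact hw _ _ _ _ (mem_nbrs.1 hb)
        · obtain ⟨a, ha, hp⟩ := Finset.mem_biUnion.1 hp
          obtain ⟨c, -, hp⟩ := Finset.mem_biUnion.1 hp
          obtain ⟨d, -, rfl⟩ := Finset.mem_image.1 hp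
          exact hw _ _ _ _ (mem_nbrs.1 ha).symm
    _ ≤ _ := by
        rw [nsmul_eq_mul]
        refine mul_le_mul_of_nonneg_right ?_ (by positivity)
        have : ((pathPatterns G v).card : ℝ) ≤ Δ * (Δ * Δ) + Δ * (Δ * Δ) := by exact_mod_cast h1
        linarith

/-- There are at most `2 ^ |Y|` choices of `U` and `c ^ (|Y| - c)` maps to representatives for each.
The leading `β` accounts for the exponent `|U| - 1` in place of `|U|`. -/
lemma sum_colorPatterns_le {β : ℝ} (hβ : 0 < β) {c : ℕ} {Y : Finset V} (hY : c < Y.card) :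
    ∑ p ∈ colorPatterns c Y, (β ^ (p.1.card - 1))⁻¹ ≤
      β * (2 ^ Y.card * (c : ℝ) ^ (Y.card - c) * (β ^ (Y.card - c))⁻¹) := by
  classical
  have hcard : (colorPatterns c Y).card ≤ 2 ^ Y.card * c ^ (Y.card - c) := by
    refine (Finset.card_biUnion_le_card_mul _ _ (c ^ (Y.card - c)) fun U hU => ?_).trans
      (Nat.mul_le_mul_right _ ?_)
    · obtain ⟨hUY, hUc⟩ := Finset.mem_filter.1 hU
      rw [Finset.mem_powerset] at hUY
      refine Finset.card_image_le.trans (le_of_eq ?_)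
      rw [Fintype.card_piFinset]
      have h1 : ∀ u : V, (if u ∈ U then Y \ U else {u}).card = if u ∈ U then c else 1 := by
        intro u
        split_ifs
        · rw [Finset.card_sdiff_of_subset hUY]; omega
        · simp
      simp only [h1]
      rw [Finset.prod_ite_mem, Finset.univ_inter, Finset.prod_const]
      congr 1; omega
    · rw [← Finset.card_powerset]
      exact Finset.card_le_card (Finset.filter_subset _ _)
  calc _ ≤ (colorPatterns c Y).card • (β * (β ^ (Y.card - c))⁻¹) := by
        refine Finset.sum_le_card_nsmul _ _ _ fun p hp => ?_
        obtain ⟨U, hU, hp⟩ := Finset.mem_biUnion.1 hp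
        obtain ⟨φ, -, rfl⟩ := Finset.mem_image.1 hp
        have hUc := (Finset.mem_filter.1 hU).2
        have h2 : Y.card - c = (U.card - 1) + 1 := by omega
        rw [h2, pow_succ]
        field_simp
        exact le_rfl
    _ ≤ _ := by
        rw [nsmul_eq_mul]
        have h3 : ((colorPatterns c Y).card : ℝ) ≤ 2 ^ Y.card * (c : ℝ) ^ (Y.card - c) := by
          exact_mod_cast hcard
        calc _ ≤ 2 ^ Y.card * (c : ℝ) ^ (Y.card - c) * (β * (β ^ (Y.card - c))⁻¹) :=
              mul_le_mul_of_nonneg_right h3 (by positivity)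
          _ = _ := by ring

/-- The critical case is `c = 3`, where `9 ≤ 9.261`; base `2` would fail there. -/
lemma sq_le_pow (c : ℕ) : (c : ℝ) ^ 2 ≤ 2.1 ^ c := by
  rcases lt_or_ge c 3 with hc | hc
  · interval_cases c <;> norm_num
  · induction c, hc using Nat.le_induction with
    | base => norm_num
    | succ n hn ih =>
      have : (3 : ℝ) ≤ n := by exact_mod_cast hn
      rw [pow_succ (2.1 : ℝ)]
      push_cast
      nlinarith

/-- Squaring replaces `m` by `2m ≥ c`. The `2.1` then beats `c ^ 2`, and the exponential in `κ` pays
for the energy of a new hub. -/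
lemma pow_le_inv_mul_exp {c m : ℕ} (hc : 1 ≤ c) (hm : c ≤ 2 * m) :
    (Real.exp (-(1 / 2)) / 2.1) ^ m ≤ (c : ℝ)⁻¹ * Real.exp (-(c / 4)) := by
  have hc0 : (0 : ℝ) < c := by exact_mod_cast hc
  have hκ1 : Real.exp (-(1 / 2)) / 2.1 ≤ 1 := by
    have : Real.exp (-(1 / 2)) ≤ 1 := Real.exp_le_one_iff.2 (by norm_num)
    rw [div_le_one (by norm_num)]; linarith
  refine (pow_le_pow_iff_left₀ (by positivity) (by positivity) two_ne_zero).1 ?_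
  calc ((Real.exp (-(1 / 2)) / 2.1) ^ m) ^ 2 = (Real.exp (-(1 / 2)) / 2.1) ^ (2 * m) := by
        rw [← pow_mul, mul_comm]
    _ ≤ (Real.exp (-(1 / 2)) / 2.1) ^ c := pow_le_pow_of_le_one (by positivity) hκ1 hm
    _ = (2.1 ^ c)⁻¹ * Real.exp (-(c / 2)) := by
        rw [div_pow, ← Real.exp_nat_mul, div_eq_mul_inv, mul_comm]
        congr 2; ring
    _ ≤ ((c : ℝ) ^ 2)⁻¹ * Real.exp (-(c / 2)) :=
        mul_le_mul_of_nonneg_right (inv_anti₀ (by positivity) (sq_le_pow c)) (Real.exp_pos _).le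
    _ = _ := by
        rw [mul_pow, inv_pow, ← Real.exp_nat_mul]
        congr 2; push_cast; ring

lemma energy_singleton_le (hΔ : ∀ u, degreeIn G Finset.univ u ≤ Δ) (c : ℕ) (v : V)
    (D : Finset V) : energy G c {v} {v} D ≤ Δ + c / 2 * Δ := by
  classical
  have h0 : energy G c ∅ ∅ D = 0 := by simp [energy, degreeIn]
  have h1 := energy_insert_le hΔ c ∅ ∅ D v
  have h2 := energy_insert_hub_le hΔ c (insert v ∅) ∅ D v
  rw [LawfulSingleton.insert_empty_eq] at h1 h2
  linarith

open Classical in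
lemma coreSets_subset_reachableSets (c : ℕ) (v : V) :
    coreSets G c v ⊆ reachableSets G {v} (Finset.univ.erase v) := by
  intro Y hY
  obtain ⟨hv, hconn, -⟩ := (Finset.mem_filter.1 hY).2
  refine Finset.mem_filter.2 ⟨Finset.mem_univ _, Finset.singleton_subset_iff.2 hv,
    fun y _ => ?_, fun P hP hPY hne => hconn P hPY ⟨v, hP (Finset.mem_singleton_self v)⟩ hne⟩
  by_cases hy : y = v <;> simp [hy]

/-- The total exploration weight of the possible dense cores at `v`. -/
lemma sum_coreSets_exploreWeight_le (hΔ : ∀ u, degreeIn G Finset.univ u ≤ Δ) (hpos : 1 ≤ Δ)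
    {c : ℕ} (hc : 1 ≤ c) (v : V) :
    ∑ Y ∈ coreSets G c v, exploreWeight G c (c * Real.exp (-(1 / 2)) / (4 * Δ))
      (Real.exp (-(1 / 2)) / 2.1) {v} {v} Y ≤ Real.exp (1 / 2 + c / 4) := by
  classical
  have hΔ0 : (0 : ℝ) < Δ := by exact_mod_cast hpos
  have hκ1 : Real.exp (-(1 / 2)) / 2.1 ≤ 1 := by
    have : Real.exp (-(1 / 2)) ≤ 1 := Real.exp_le_one_iff.2 (by norm_num)
    rw [div_le_one (by norm_num)]; linarith
  have ha : (1 / (2 * Δ) : ℝ) * Δ = 1 / 2 := by field_simp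
  have hee : Real.exp (-(1 / 2)) * Real.exp (1 / 2) = 1 := by rw [← Real.exp_add]; simp
  calc _ ≤ ∑ Y ∈ reachableSets G {v} (Finset.univ.erase v), exploreWeight G c
        (c * Real.exp (-(1 / 2)) / (4 * Δ)) (Real.exp (-(1 / 2)) / 2.1) {v} {v} Y :=
        Finset.sum_le_sum_of_subset_of_nonneg (coreSets_subset_reachableSets c v)
          fun _ _ _ => exploreWeight_nonneg (by positivity) (by positivity) _ _ _
    _ ≤ Real.exp (1 / (2 * Δ) * energy G c {v} {v} (Finset.univ.erase v)) := by
        -- With `a = 1 / (2Δ)`, the choice of `z` makes the first condition an equality, and the hub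
        -- condition is `pow_le_inv_mul_exp`.
        refine sum_exploreWeight_le hc (by positivity) hΔ (by positivity) (by positivity) hκ1
          ?_ (fun m hm => ?_) _ _ _ (by simp)
        · rw [ha]
          refine le_of_eq ?_
          calc _ = (c : ℝ) / (2 * Δ) * (Real.exp (-(1 / 2)) * Real.exp (1 / 2)) := by
                field_simp; norm_num
            _ = _ := by rw [hee]; field_simp
        · refine (pow_le_inv_mul_exp hc hm).trans (le_of_eq ?_)
          congr 3
          field_simp; norm_num
    _ ≤ _ := by
        refine Real.exp_le_exp.2 ?_
        calc _ ≤ 1 / (2 * Δ) * (Δ + c / 2 * Δ : ℝ) :=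
              mul_le_mul_of_nonneg_left (energy_singleton_le hΔ c v _) (by positivity)
          _ = _ := by field_simp; ring

open Classical in
-- A candidate core has at most `c` low-degree vertices, so the discount `1 / c` is applied at most
-- `c` times; the factor `κ` is applied at most once per vertex.
lemma le_exploreWeight {c : ℕ} (hc : 1 ≤ c) {z κ : ℝ} (hz : 0 ≤ z) (hκ : 0 ≤ κ) (hκ1 : κ ≤ 1)
    {v : V} {Y : Finset V} (hY : Y ∈ coreSets G c v) :
    z ^ (Y.card - 1) * ((c : ℝ)⁻¹) ^ c * κ ^ Y.card ≤ exploreWeight G c z κ {v} {v} Y := by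
  obtain ⟨hv, -, -, hlow⟩ := (Finset.mem_filter.1 hY).2
  have hc' : (c : ℝ)⁻¹ ≤ 1 := inv_le_one_of_one_le₀ (by exact_mod_cast hc)
  have h1 : (Y \ {v}).card = Y.card - 1 := by
    rw [Finset.card_sdiff_of_subset (Finset.singleton_subset_iff.2 hv), Finset.card_singleton]
  unfold exploreWeight
  rw [h1]
  refine mul_le_mul (mul_le_mul_of_nonneg_left ?_ (by positivity)) ?_ (by positivity)
    (by positivity)
  · refine pow_le_pow_of_le_one (by positivity) hc' ((Finset.card_le_card ?_).trans hlow)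
    exact Finset.filter_subset_filter _ Finset.sdiff_subset
  · refine pow_le_pow_of_le_one hκ hκ1 (Finset.card_le_card ?_)
    exact (Finset.filter_subset _ _).trans Finset.sdiff_subset

/-- This is where the exponent `3/2` enters. Group `3c` of the factors into triples, each absorbed
by `A * β ^ 2`, and bound the others by `β`. With `M` of order `Δ`, the triples require `β` of order
`Δ ^ (3/2)`. -/
lemma pow_le_of_three_mul_le {M A β : ℝ} (hM : 0 ≤ M)
    (h1 : M ≤ β) (h3 : M ^ 3 ≤ A * β ^ 2) {c J : ℕ} (hJ : 3 * c ≤ J) :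
    M ^ J ≤ A ^ c * β ^ (J - c) := by
  obtain ⟨i, rfl⟩ := Nat.exists_eq_add_of_le hJ
  have h2 : 3 * c + i - c = 2 * c + i := by omega
  rw [h2, pow_add, pow_add, ← mul_assoc]
  refine mul_le_mul ?_ (pow_le_pow_left₀ hM h1 i) (by positivity) ?_
  · calc M ^ (3 * c) = (M ^ 3) ^ c := pow_mul _ _ _
      _ ≤ (A * β ^ 2) ^ c := pow_le_pow_left₀ (by positivity) h3 c
      _ = _ := by rw [mul_pow, ← pow_mul]
  · calc 0 ≤ (M ^ 3) ^ c := by positivity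
      _ ≤ (A * β ^ 2) ^ c := pow_le_pow_left₀ (by positivity) h3 c
      _ = _ := by rw [mul_pow, ← pow_mul]

lemma color_weight_le {A β : ℝ} {c J : ℕ} (hc : 1 ≤ c) (hpos : 1 ≤ Δ) (hβ : 0 < β)
    (h1 : 16.8 * Real.exp 1 * Δ ≤ β) (h3 : (16.8 * Real.exp 1 * Δ) ^ 3 ≤ A * β ^ 2)
    (hJ : 3 * c ≤ J) :
    2 ^ J * (c : ℝ) ^ (J - c) * (β ^ (J - c))⁻¹ ≤
      c * Real.exp (-(1 / 2)) / (4 * Δ) * A ^ c *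
        ((c * Real.exp (-(1 / 2)) / (4 * Δ)) ^ (J - 1) * ((c : ℝ)⁻¹) ^ c *
          (Real.exp (-(1 / 2)) / 2.1) ^ J) := by
  have hc0 : (0 : ℝ) < c := by exact_mod_cast hc
  have hΔ0 : (0 : ℝ) < Δ := by exact_mod_cast hpos
  -- Chosen so that `z * κ = 2c / M`, with `16.8 = 2 * 4 * 2.1`.
  set M := 16.8 * Real.exp 1 * Δ with hM
  have hM0 : 0 < M := by positivity
  set z := c * Real.exp (-(1 / 2)) / (4 * Δ) with hz
  have hzκ : z * (Real.exp (-(1 / 2)) / 2.1) = c * 2 * M⁻¹ := by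
    have : Real.exp (-(1 / 2)) * Real.exp (-(1 / 2)) = (Real.exp 1)⁻¹ := by
      rw [← Real.exp_add, ← Real.exp_neg]; norm_num
    calc _ = c * (Real.exp (-(1 / 2)) * Real.exp (-(1 / 2))) / (4 * Δ * 2.1) := by
          rw [hz]; field_simp
      _ = _ := by rw [this, hM]; field_simp; norm_num
  have hzJ : z * z ^ (J - 1) = z ^ J := by
    rw [← pow_succ']; congr 1; omega
  have hcJ : (c : ℝ) ^ J * ((c : ℝ)⁻¹) ^ c = (c : ℝ) ^ (J - c) := by
    have : J = (J - c) + c := by omega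
    conv_lhs => rw [this, pow_add, mul_assoc, ← mul_pow, mul_inv_cancel₀ hc0.ne', one_pow, mul_one]
  have hrhs : z * A ^ c * (z ^ (J - 1) * ((c : ℝ)⁻¹) ^ c * (Real.exp (-(1 / 2)) / 2.1) ^ J) =
      2 ^ J * (c : ℝ) ^ (J - c) * (A ^ c * (M ^ J)⁻¹) := by
    calc _ = A ^ c * (z * z ^ (J - 1) * (Real.exp (-(1 / 2)) / 2.1) ^ J) * ((c : ℝ)⁻¹) ^ c := by
          ring
      _ = A ^ c * (c * 2 * M⁻¹) ^ J * ((c : ℝ)⁻¹) ^ c := by rw [hzJ, ← mul_pow, hzκ]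
      _ = A ^ c * (2 ^ J * (M ^ J)⁻¹) * ((c : ℝ) ^ J * ((c : ℝ)⁻¹) ^ c) := by
          rw [mul_pow, mul_pow, inv_pow]; ring
      _ = _ := by rw [hcJ]; ring
  rw [hrhs]
  refine mul_le_mul_of_nonneg_left ?_ (by positivity)
  rw [← div_eq_mul_inv, le_div_iff₀ (by positivity), inv_mul_eq_div, div_le_iff₀ (by positivity)]
  exact pow_le_of_three_mul_le hM0.le h1 h3 hJ

lemma two_mul_le_two_pow (c : ℕ) : 2 * c ≤ 2 ^ c := by
  induction c with
  | zero => simp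
  | succ n ih =>
    rcases n with _ | n
    · simp
    · have : 2 ≤ 2 ^ (n + 1) := Nat.le_self_pow (by simp) 2
      rw [pow_succ 2 (n + 1)]; omega

lemma exp_quarter_le : Real.exp (1 / 4) ≤ 1.3 := by
  refine (pow_le_pow_iff_left₀ (Real.exp_pos _).le (by norm_num) (by norm_num : 4 ≠ 0)).1 ?_
  rw [← Real.exp_nat_mul]
  have := Real.exp_one_lt_d9
  norm_num at this ⊢
  linarith

lemma sum_coreSets_colorPatterns_le (hΔ : ∀ u, degreeIn G Finset.univ u ≤ Δ) (hpos : 1 ≤ Δ)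
    {β : ℝ} (hβ : 0 < β) (h1 : 16.8 * Real.exp 1 * Δ ≤ β)
    (h3 : (16.8 * Real.exp 1 * Δ) ^ 3 ≤ 0.12 * β ^ 2) {c : ℕ} (hc : 1 ≤ c) (v : V) :
    ∑ Y ∈ coreSets G c v, ∑ p ∈ colorPatterns c Y, (β ^ (p.1.card - 1))⁻¹ ≤
      β / 8 * (1 / 3) ^ c := by
  classical
  have hc0 : (0 : ℝ) < c := by exact_mod_cast hc
  have hΔ0 : (0 : ℝ) < Δ := by exact_mod_cast hpos
  have hΔ1 : (1 : ℝ) ≤ Δ := by exact_mod_cast hpos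
  have hκ1 : Real.exp (-(1 / 2)) / 2.1 ≤ 1 := by
    have : Real.exp (-(1 / 2)) ≤ 1 := Real.exp_le_one_iff.2 (by norm_num)
    rw [div_le_one (by norm_num)]; linarith
  set z := c * Real.exp (-(1 / 2)) / (4 * Δ) with hz
  have hz0 : 0 ≤ z := by positivity
  calc _ ≤ ∑ Y ∈ coreSets G c v, β * (z * 0.12 ^ c * exploreWeight G c z
        (Real.exp (-(1 / 2)) / 2.1) {v} {v} Y) := by
        refine Finset.sum_le_sum fun Y hY => ?_
        have hJ := (Finset.mem_filter.1 hY).2.2.2.1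
        refine (sum_colorPatterns_le hβ (by omega)).trans (mul_le_mul_of_nonneg_left ?_ hβ.le)
        exact (color_weight_le hc hpos hβ h1 h3 hJ).trans (mul_le_mul_of_nonneg_left
          (le_exploreWeight hc hz0 (by positivity) hκ1 hY) (by positivity))
    _ = β * (z * 0.12 ^ c) * ∑ Y ∈ coreSets G c v, exploreWeight G c z
        (Real.exp (-(1 / 2)) / 2.1) {v} {v} Y := by
        rw [Finset.mul_sum]; exact Finset.sum_congr rfl fun _ _ => by ring
    _ ≤ β * (z * 0.12 ^ c) * Real.exp (1 / 2 + c / 4) :=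
        mul_le_mul_of_nonneg_left (sum_coreSets_exploreWeight_le hΔ hpos hc v) (by positivity)
    _ = β / 8 * (2 * c * (0.12 * Real.exp (1 / 4)) ^ c) * (1 / Δ) := by
        have h4 : Real.exp (1 / 2 + c / 4) = Real.exp (1 / 2) * Real.exp (1 / 4) ^ c := by
          rw [Real.exp_add, ← Real.exp_nat_mul]; congr 2; ring
        have hee : Real.exp (-(1 / 2)) * Real.exp (1 / 2) = 1 := by rw [← Real.exp_add]; simp
        rw [h4, hz, mul_pow]
        calc _ = β * (c / (4 * Δ)) * (0.12 ^ c * Real.exp (1 / 4) ^ c) *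
              (Real.exp (-(1 / 2)) * Real.exp (1 / 2)) := by ring
          _ = _ := by rw [hee]; field_simp; norm_num
    _ ≤ β / 8 * (2 * c * (0.12 * Real.exp (1 / 4)) ^ c) * 1 := by
        refine mul_le_mul_of_nonneg_left ?_ (by positivity)
        rw [div_le_one hΔ0]; exact hΔ1
    -- `0.12 * 1.3 < 1/6`, leaving a geometric series of ratio `1/3` in the number of colors.
    _ ≤ β / 8 * (2 ^ c * (1 / 6) ^ c) := by
        rw [mul_one]
        refine mul_le_mul_of_nonneg_left (mul_le_mul ?_ ?_ (by positivity) (by positivity))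
          (by positivity)
        · exact_mod_cast two_mul_le_two_pow c
        · refine pow_le_pow_left₀ (by positivity) ?_ c
          have := exp_quarter_le
          norm_num at this ⊢
          linarith
    _ = _ := by rw [← mul_pow]; norm_num

lemma sum_third_pow_le (n : ℕ) : ∑ i ∈ Finset.range n, (1 / 3 : ℝ) ^ (i + 1) ≤ 1 / 2 := by
  have h : ∑ i ∈ Finset.range n, (1 / 3 : ℝ) ^ (i + 1) = 1 / 2 - 1 / 2 * (1 / 3) ^ n := by
    induction n with
    | zero => simp
    | succ n ih => rw [Finset.sum_range_succ, ih]; ring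
  rw [h]
  have : (0 : ℝ) ≤ 1 / 2 * (1 / 3) ^ n := by positivity
  linarith

lemma sum_corePatterns_le (hΔ : ∀ u, degreeIn G Finset.univ u ≤ Δ) (hpos : 1 ≤ Δ)
    {β : ℝ} (hβ : 0 < β) (h1 : 16.8 * Real.exp 1 * Δ ≤ β)
    (h3 : (16.8 * Real.exp 1 * Δ) ^ 3 ≤ 0.12 * β ^ 2) (v : V) :
    ∑ p ∈ corePatterns G v, (β ^ (p.1.card - 1))⁻¹ ≤ β / 16 := by
  classical
  have hg : ∀ p : Finset V × (V → V), 0 ≤ (β ^ (p.1.card - 1))⁻¹ := fun p => by positivity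
  calc _ ≤ ∑ i ∈ Finset.range (Fintype.card V), β / 8 * (1 / 3 : ℝ) ^ (i + 1) := by
        refine (sum_biUnion_le_of_nonneg _ _ hg).trans (Finset.sum_le_sum fun i _ => ?_)
        exact (sum_biUnion_le_of_nonneg _ _ hg).trans
          (sum_coreSets_colorPatterns_le hΔ hpos hβ h1 h3 (Nat.le_add_left 1 i) v)
    _ = β / 8 * ∑ i ∈ Finset.range (Fintype.card V), (1 / 3 : ℝ) ^ (i + 1) := by
        rw [Finset.mul_sum]
    _ ≤ β / 8 * (1 / 2) := mul_le_mul_of_nonneg_left (sum_third_pow_le _) (by positivity)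
    _ = _ := by ring

/-- In units of `s³`, edges, small vertices and paths cost at most `1` each and cores at most
`900/16 = 56.25`, within the available `100`. -/
lemma sum_badPatterns_le (hΔ : ∀ u, degreeIn G Finset.univ u ≤ Δ) (hpos : 1 ≤ Δ)
    {s : ℝ} (hs : 1 ≤ s) (hsΔ : s ^ 2 = Δ)
    (hsmall : ∀ u, small u → (degreeIn G Finset.univ u : ℝ) ≤ s) (v : V) :
    ∑ p ∈ badPatterns G small v, ((900 * s ^ 3) ^ (p.1.card - 1))⁻¹ ≤
      1000 * s ^ 3 - 900 * s ^ 3 := by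
  classical
  have hs0 : 0 < s := by linarith
  set β := 900 * s ^ 3 with hβdef
  have hβ : 0 < β := by positivity
  have he : Real.exp 1 ≤ 2.7183 := by
    have := Real.exp_one_lt_d9
    norm_num at this ⊢; linarith
  have hs3 : s ^ 2 ≤ s ^ 3 := pow_le_pow_right₀ hs (by norm_num)
  have hM : 16.8 * Real.exp 1 * Δ ≤ 45.7 * s ^ 2 := by
    rw [← hsΔ]
    refine mul_le_mul_of_nonneg_right ?_ (by positivity)
    norm_num at he ⊢; linarith
  have h1 : 16.8 * Real.exp 1 * Δ ≤ β := by
    refine hM.trans ?_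
    rw [hβdef]
    have : (0 : ℝ) ≤ s ^ 3 := by positivity
    norm_num
    linarith
  have h3 : (16.8 * Real.exp 1 * Δ) ^ 3 ≤ 0.12 * β ^ 2 := by
    refine (pow_le_pow_left₀ (by positivity) hM 3).trans ?_
    have h6 : (0 : ℝ) ≤ s ^ 6 := by positivity
    -- The binding constraint on `900`: `45.7 ^ 3 < 95500`, while `0.12 * 900 ^ 2 = 97200`.
    calc (45.7 * s ^ 2) ^ 3 = 45.7 ^ 3 * s ^ 6 := by ring
      _ ≤ 0.12 * 900 ^ 2 * s ^ 6 := mul_le_mul_of_nonneg_right (by norm_num) h6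
      _ = _ := by rw [hβdef]; ring
  have hg : ∀ p : Finset V × (V → V), 0 ≤ (β ^ (p.1.card - 1))⁻¹ := fun p => by positivity
  have hpath : 2 * (Δ : ℝ) ^ 3 * β⁻¹ ≤ s ^ 3 := by
    rw [← div_eq_mul_inv, div_le_iff₀ hβ, ← hsΔ, hβdef]
    have h6 : (0 : ℝ) ≤ s ^ 6 := by positivity
    calc 2 * (s ^ 2) ^ 3 = 2 * s ^ 6 := by ring
      _ ≤ 900 * s ^ 6 := by linarith
      _ = _ := by ring
  calc _ ≤ (∑ p ∈ edgePatterns G v, (β ^ (p.1.card - 1))⁻¹ +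
          ∑ p ∈ smallPatterns G small v, (β ^ (p.1.card - 1))⁻¹) +
        (∑ p ∈ pathPatterns G v, (β ^ (p.1.card - 1))⁻¹ +
          ∑ p ∈ corePatterns G v, (β ^ (p.1.card - 1))⁻¹) :=
        (sum_union_le_of_nonneg _ _ hg).trans
          (add_le_add (sum_union_le_of_nonneg _ _ hg) (sum_union_le_of_nonneg _ _ hg))
    _ ≤ ((Δ : ℝ) + Δ * s) + (2 * (Δ : ℝ) ^ 3 * β⁻¹ + β / 16) :=
        add_le_add (add_le_add (sum_edgePatterns_le hΔ β v)
          (sum_smallPatterns_le hΔ hs0.le hsmall β v))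
          (add_le_add (sum_pathPatterns_le hΔ hβ v) (sum_corePatterns_le hΔ hpos hβ h1 h3 v))
    _ ≤ _ := by
        have h4 : (Δ : ℝ) ≤ s ^ 3 := hsΔ ▸ hs3
        have h5 : (Δ : ℝ) * s = s ^ 3 := by rw [← hsΔ]; ring
        have h6 : 0 < s ^ 3 := by positivity
        rw [h5, hβdef] at *
        linarith

end Weights

end DegStar

/-! ### Assembling the theorem. -/

/-- A finite simple graph has a degenerate star coloring from any lists of size at least
`1000 * Δ ^ (3 / 2)`, with distinct colors around the vertices of degree at most `Δ ^ (1 / 2)`. -/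
theorem DegStar.exists_degenerateStarColoring {V : Type*} [Fintype V] {G : SimpleGraph V} {Δ : ℕ}
    (hΔ : ∀ u, DegStar.degreeIn G Finset.univ u ≤ Δ) (hpos : 1 ≤ Δ) {s : ℝ} (hs : 1 ≤ s)
    (hsΔ : s ^ 2 = Δ) (L : V → Finset ℕ) (hL : ∀ v, 1000 * s ^ 3 ≤ (L v).card) :
    ∃ f : V → ℕ, (∀ v, f v ∈ L v) ∧ DegStar.IsDegenerateStarColoring G f ∧
      ∀ v, (DegStar.degreeIn G Finset.univ v : ℝ) ≤ s →
        ∀ x y, G.Adj v x → G.Adj v y → x ≠ y → f x ≠ f y := by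
  obtain ⟨f, hfL, hproper, hpath, hsmall, hcore⟩ := DegStar.exists_good_list_coloring
    (good := DegStar.IsGoodOn G fun u => (DegStar.degreeIn G Finset.univ u : ℝ) ≤ s)
    (β := 900 * s ^ 3) (by positivity) hL DegStar.isGoodOn_empty
    (fun _ _ _ hST h => h.mono hST) (fun _ _ _ hfg h => h.congr hfg)
    (DegStar.badPatterns G _) (fun _ _ _ _ hS hbad => DegStar.exists_badPattern hS hbad)
    (DegStar.sum_badPatterns_le hΔ hpos hs hsΔ fun _ h => h)
  replace hproper : ∀ x y, G.Adj x y → f x ≠ f y := fun x y => hproper x (by simp) y (by simp)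
  replace hpath : ∀ a b c d, [a, b, c, d].Nodup → G.Adj a b → G.Adj b c → G.Adj c d →
      ¬ (f a = f c ∧ f b = f d) :=
    fun a b c d => hpath a (by simp) b (by simp) c (by simp) d (by simp)
  refine ⟨f, hfL, ⟨DegStar.isDegenerateColoring_of_forall_not_isDenseCore hproper hpath
    fun Y => hcore Y (Finset.subset_univ _), hproper, fun a b c d hnd hab hbc hcd hcard => ?_⟩,
    fun v hv x y => hsmall v hv x (by simp) y (by simp)⟩
  have h1 := hproper a b hab
  have h2 := hproper b c hbc
  have h3 := hproper c d hcd
  -- A properly colored path with only two colors must alternate; otherwise three consecutive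
  -- vertices already show three colors.
  refine hpath a b c d hnd hab hbc hcd ⟨?_, ?_⟩
  · by_contra hac
    have : 3 ≤ ({f a, f b, f c, f d} : Finset ℕ).card :=
      calc 3 = ({f a, f b, f c} : Finset ℕ).card := by
            rw [Finset.card_eq_three.2 ⟨f a, f b, f c, h1, hac, h2, rfl⟩]
        _ ≤ _ := Finset.card_le_card fun x => by simp; tauto
    omega
  · by_contra hbd
    have : 3 ≤ ({f a, f b, f c, f d} : Finset ℕ).card :=
      calc 3 = ({f b, f c, f d} : Finset ℕ).card := by
            rw [Finset.card_eq_three.2 ⟨f b, f c, f d, h2, hbd, h3, rfl⟩]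
        _ ≤ _ := Finset.card_le_card fun x => by simp; tauto
    omega

theorem theorem2p3 {V : Type*} [Fintype V] (G : SimpleGraph V) [DecidableRel G.Adj]
    (Δ : ℕ) (hΔ : G.maxDegree = Δ) (hpos : 1 ≤ Δ) :
    (∀ L : V → Set ℕ, (∀ v, ((⌈1000 * (Δ : ℝ) ^ (3 / 2 : ℝ)⌉₊ : ℕ) : ℕ∞) ≤ (L v).encard) →
      ∃ f : V → ℕ, (∀ v, f v ∈ L v) ∧ DegStar.IsDegenerateStarColoring G f ∧
        ∀ v, (G.degree v : ℝ) ≤ (Δ : ℝ) ^ (1 / 2 : ℝ) →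
          ∀ x y, G.Adj v x → G.Adj v y → x ≠ y → f x ≠ f y) ∧
    DegStar.degenerateStarChromaticNumber G ≤ ((⌈1000 * (Δ : ℝ) ^ (3 / 2 : ℝ)⌉₊ : ℕ) : ℕ∞) := by
  have hdeg : ∀ u, DegStar.degreeIn G Finset.univ u = G.degree u := by
    intro u
    rw [← G.card_neighborFinset_eq_degree, G.neighborFinset_eq_filter, DegStar.degreeIn]
    congr
  have hΔ' : ∀ u, DegStar.degreeIn G Finset.univ u ≤ Δ := fun u => by
    rw [hdeg, ← hΔ]; exact G.degree_le_maxDegree u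
  have hΔ0 : (0 : ℝ) ≤ Δ := by positivity
  set s : ℝ := (Δ : ℝ) ^ (1 / 2 : ℝ) with hs
  have hs1 : 1 ≤ s := Real.one_le_rpow (by exact_mod_cast hpos) (by norm_num)
  have hsΔ : s ^ 2 = Δ := by
    rw [hs, ← Real.rpow_natCast, ← Real.rpow_mul hΔ0]; norm_num
  have hs3 : (Δ : ℝ) ^ (3 / 2 : ℝ) = s ^ 3 := by
    rw [hs, ← Real.rpow_natCast, ← Real.rpow_mul hΔ0]; norm_num
  rw [hs3]
  set n := ⌈1000 * s ^ 3⌉₊ with hn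
  have main : ∀ L : V → Set ℕ, (∀ v, (n : ℕ∞) ≤ (L v).encard) →
      ∃ f : V → ℕ, (∀ v, f v ∈ L v) ∧ DegStar.IsDegenerateStarColoring G f ∧
        ∀ v, (G.degree v : ℝ) ≤ s → ∀ x y, G.Adj v x → G.Adj v y → x ≠ y → f x ≠ f y := by
    intro L hL
    -- Lists may be infinite, so each is cut down to exactly `n` colors.
    have hex : ∀ v, ∃ t : Finset ℕ, (t : Set ℕ) ⊆ L v ∧ t.card = n := by
      intro v
      obtain ⟨t, ht, htc⟩ := Set.exists_subset_encard_eq (hL v)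
      have hfin : t.Finite := Set.finite_of_encard_eq_coe htc
      refine ⟨hfin.toFinset, by simpa using ht, ?_⟩
      rw [hfin.encard_eq_coe_toFinset_card] at htc
      exact_mod_cast htc
    choose L' hL' hcard using hex
    obtain ⟨f, h1, h2, h3⟩ := DegStar.exists_degenerateStarColoring hΔ' hpos hs1 hsΔ L'
      fun v => by rw [hcard]; exact Nat.le_ceil _
    refine ⟨f, fun v => hL' v (h1 v), h2, fun v hv => h3 v ?_⟩
    rw [hdeg]; exact hv
  refine ⟨main, ?_⟩
  have hcard : (Finset.range n : Set ℕ).encard = n := by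
    rw [Set.encard_coe_eq_coe_finsetCard, Finset.card_range]
  -- Giving every vertex the same list of `n` colors bounds the range of `f`.
  obtain ⟨f, hf, hstar, -⟩ := main (fun _ => (Finset.range n : Set ℕ)) fun _ => hcard.ge
  refine iInf₂_le n ⟨f, ?_, hstar⟩
  rw [← hcard]
  exact Set.encard_le_encard (Set.range_subset_iff.2 hf)
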